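/- A labelled Petri net $N=(P,T,F,\sigma)$ consists of finite disjoint sets $P$ of places and $T$ of transitions, a set of edges $F\subseteq (P\times T)\cup(T\times P)$, and a labelling $\sigma$ of the transitions by $\tau$ or by visible actions; $|N|=|P|+|T|+|F|$. For a marking $M_0:P\to\mathbb N$, $LTS(N,M_0)$ is the labelled transition system whose states are the markings reachable from $M_0$ by the firing rule (a transition $t$ is enabled if every place with an edge to $t$ holds a token; firing it emits $\sigma(t)$, removes one token from each place with an edge to $t$ and adds one token to each place with an edge from $t$). The net $N$ is a group-choice net if for any two places $p,q$ the postsets $p\bullet=\{t\mid (p,t)\in F\}$ and $q\bullet$ are equal or disjoint. CCS processes are given by $\mu ::= \tau\mid a\mid\overline a$, $P::=\mathbf 0\mid \mu.Q\mid P+P'$, $Q::=P\mid Q\,|\,Q'\mid(\nu a)Q\mid X$, with the usual operational rules; process names $X$ are interpreted by a finite partial map $\mathcal D$ of defining equations. $LTS(Q,\mathcal D)$ is the labelled transition system of the processes reachable from $Q$. A divergent path of a labelled transition system is an infinite sequence of its states in which each state has a $\tau$-transition to the next. **Theorem.** There are an algorithm (a program for a unit-cost random access machine with addition and subtraction) and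 a constant $C$ such that, for every group-choice net $N$ and every initial marking $M_0$, the algorithm, given $N$ (as adjacency lists of outgoing edges, in any order) and $M_0$, halts after at most $C\,(|N|+\sum_{p\in P}M_0(p)+1)$ steps and outputs a CCS process $Q$ with defining equations $\mathcal D$ such that 1. $LTS(N,M_0)$ and $LTS(Q,\mathcal D)$ are weakly bisimilar; 2. $LTS(N,M_0)$ has a divergent path if and only if $LTS(Q,\mathcal D)$ has one; 3. the size of $(Q,\mathcal D)$ (the number of operators, prefixes and process names in $Q$ and in the equations) is at most $C\,(|N|+\sum_{p\in P}M_0(p)+1)$. -/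

import Mathlib

namespace NetToCCS

/-! ## Labelled transition systems, weak bisimilarity, divergence -/

/-- CCS actions over the countably infinite set `ℕ` of visible action names:
`tau` is the internal action, `act a` the visible action `a`, `co a` its co-action. -/
inductive Act where
  | tau : Act
  | act (a : ℕ) : Act
  | co (a : ℕ) : Act

/-- A labelled transition system with a distinguished initial state.  The system proper consists
of the states that are reachable from `init` (see `LTS.Reachable`). -/
structure LTS where
  State : Type*
  init : State
  tr : State → Act → State → Prop

namespace LTS

/-- `q ⟹ε q'`: zero or more internal steps. -/
def TauStar (L : LTS) : L.State → L.State → Prop :=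
  Relation.ReflTransGen fun q q' => L.tr q Act.tau q'

/-- `q ⟹μ q'`: one `μ`-step, preceded and followed by zero or more internal steps. -/
def WeakTr (L : LTS) (q : L.State) (μ : Act) (q' : L.State) : Prop :=
  ∃ q₁ q₂, L.TauStar q q₁ ∧ L.tr q₁ μ q₂ ∧ L.TauStar q₂ q'

/-- Weak bisimulations between two labelled transition systems. -/
structure IsWeakBisimulation (L₁ L₂ : LTS) (R : L₁.State → L₂.State → Prop) : Prop where
  visible_left : ∀ q₁ q₂ μ q₁', R q₁ q₂ → μ ≠ Act.tau → L₁.tr q₁ μ q₁' →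
    ∃ q₂', L₂.WeakTr q₂ μ q₂' ∧ R q₁' q₂'
  tau_left : ∀ q₁ q₂ q₁', R q₁ q₂ → L₁.tr q₁ Act.tau q₁' →
    ∃ q₂', L₂.TauStar q₂ q₂' ∧ R q₁' q₂'
  visible_right : ∀ q₁ q₂ μ q₂', R q₁ q₂ → μ ≠ Act.tau → L₂.tr q₂ μ q₂' →
    ∃ q₁', L₁.WeakTr q₁ μ q₁' ∧ R q₁' q₂'
  tau_right : ∀ q₁ q₂ q₂', R q₁ q₂ → L₂.tr q₂ Act.tau q₂' →
    ∃ q₁', L₁.TauStar q₁ q₁' ∧ R q₁' q₂'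

/-- Weak bisimilarity of (the initial states of) two labelled transition systems. -/
def WeaklyBisimilar (L₁ L₂ : LTS) : Prop :=
  ∃ R : L₁.State → L₂.State → Prop, IsWeakBisimulation L₁ L₂ R ∧ R L₁.init L₂.init

/-- The state `q` can be reached from the initial state. -/
def Reachable (L : LTS) (q : L.State) : Prop :=
  Relation.ReflTransGen (fun q q' => ∃ μ, L.tr q μ q') L.init q

/-- The system has a divergent path: an infinite sequence of internal steps through (reachable)
states. -/
def HasDivergentPath (L : LTS) : Prop :=
  ∃ q : ℕ → L.State, L.Reachable (q 0) ∧ ∀ i, L.tr (q i) Act.tau (q (i + 1))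

end LTS

/-! ## CCS -/

mutual
  /-- Sequential CCS processes `P ::= 0 | μ.Q | P + P'`. -/
  inductive SeqProc where
    | nil : SeqProc
    | pre (μ : Act) (Q : Proc) : SeqProc
    | sum (P P' : SeqProc) : SeqProc
  /-- CCS processes `Q ::= P | Q ∣ Q' | (ν a) Q | X`; process names `X` are natural numbers. -/
  inductive Proc where
    | seq (P : SeqProc) : Proc
    | par (Q Q' : Proc) : Proc
    | res (a : ℕ) (Q : Proc) : Proc
    | name (X : ℕ) : Proc
end

/-- Transitions of sequential processes. -/
inductive SeqStep : SeqProc → Act → Proc → Prop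
  | pref (μ : Act) (Q : Proc) : SeqStep (SeqProc.pre μ Q) μ Q
  | sum1 {P₁ P₂ : SeqProc} {μ : Act} {Q : Proc} : SeqStep P₁ μ Q → SeqStep (SeqProc.sum P₁ P₂) μ Q
  | sum2 {P₁ P₂ : SeqProc} {μ : Act} {Q : Proc} : SeqStep P₂ μ Q → SeqStep (SeqProc.sum P₁ P₂) μ Q

/-- Transitions of CCS processes, where the partial map `D` holds the defining equations. -/
inductive Step (D : ℕ → Option Proc) : Proc → Act → Proc → Prop
  | seq {P : SeqProc} {μ : Act} {Q : Proc} : SeqStep P μ Q → Step D (Proc.seq P) μ Q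
  | cons {X : ℕ} {Q Q' : Proc} {μ : Act} : D X = some Q → Step D Q μ Q' →
      Step D (Proc.name X) μ Q'
  | par1 {Q₁ Q₂ Q₁' : Proc} {μ : Act} : Step D Q₁ μ Q₁' →
      Step D (Proc.par Q₁ Q₂) μ (Proc.par Q₁' Q₂)
  | par2 {Q₁ Q₂ Q₂' : Proc} {μ : Act} : Step D Q₂ μ Q₂' →
      Step D (Proc.par Q₁ Q₂) μ (Proc.par Q₁ Q₂')
  | com1 {Q₁ Q₂ Q₁' Q₂' : Proc} {a : ℕ} : Step D Q₁ (Act.act a) Q₁' →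
      Step D Q₂ (Act.co a) Q₂' → Step D (Proc.par Q₁ Q₂) Act.tau (Proc.par Q₁' Q₂')
  | com2 {Q₁ Q₂ Q₁' Q₂' : Proc} {a : ℕ} : Step D Q₁ (Act.co a) Q₁' →
      Step D Q₂ (Act.act a) Q₂' → Step D (Proc.par Q₁ Q₂) Act.tau (Proc.par Q₁' Q₂')
  | res {a : ℕ} {Q Q' : Proc} {μ : Act} : Step D Q μ Q' → μ ≠ Act.act a → μ ≠ Act.co a →
      Step D (Proc.res a Q) μ (Proc.res a Q')

/-- A CCS process together with a finite list of equations `X = Q'`. -/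
structure CCSSystem where
  proc : Proc
  eqs : List (ℕ × Proc)

namespace CCSSystem

/-- No process name is defined twice. -/
def WellFormed (S : CCSSystem) : Prop := (S.eqs.map Prod.fst).Nodup

/-- The partial map of defining equations. -/
def defs (S : CCSSystem) : ℕ → Option Proc := fun X => S.eqs.lookup X

/-- `LTS(Q, D)`. -/
def toLTS (S : CCSSystem) : LTS where
  State := Proc
  init := S.proc
  tr := Step S.defs

end CCSSystem

/-! ### Size and written form of a CCS process with defining equations -/

mutual
  /-- Number of operators, prefixes and names in a sequential process. -/
  def SeqProc.size : SeqProc → ℕ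
    | .nil => 1
    | .pre _ Q => 1 + Q.size
    | .sum P P' => 1 + P.size + P'.size
  /-- Number of operators, prefixes and names in a process. -/
  def Proc.size : Proc → ℕ
    | .seq P => P.size
    | .par Q Q' => 1 + Q.size + Q'.size
    | .res _ Q => 1 + Q.size
    | .name _ => 1
end

/-- Size of a process with its defining equations. -/
def CCSSystem.size (S : CCSSystem) : ℕ :=
  S.proc.size + (S.eqs.map fun e => 1 + e.2.size).sum

/-- The token(s) for an action prefix. -/
def Act.write : Act → List ℕ
  | .tau => [1]
  | .act a => [2, a]
  | .co a => [3, a]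

mutual
  /-- Prefix (Polish) notation of a sequential process. -/
  def SeqProc.write : SeqProc → List ℕ
    | .nil => [0]
    | .pre μ Q => μ.write ++ Q.write
    | .sum P P' => 4 :: (P.write ++ P'.write)
  /-- Prefix (Polish) notation of a process. -/
  def Proc.write : Proc → List ℕ
    | .seq P => P.write
    | .par Q Q' => 5 :: (Q.write ++ Q'.write)
    | .res a Q => 6 :: a :: Q.write
    | .name X => [7, X]
end

/-- The written form of a process with its defining equations: the process, followed by
the equations, each as the defined name and the prefix notation of its right-hand side. -/
def CCSSystem.write (S : CCSSystem) : List ℕ :=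
  S.proc.write ++ S.eqs.flatMap fun e => e.1 :: e.2.write

/-! ## Petri nets -/

/-- A labelled Petri net with finite set of places `P` and finite set of transitions `T`.
The edge set is the disjoint union of `inEdges` (from places to transitions) and `outEdges` (from
transitions to places).  A label is `none` (the internal action) or `some a` (the visible action
`a`); co-actions do not occur in nets. -/
structure PetriNet (P T : Type*) where
  inEdges : Finset (P × T)
  outEdges : Finset (T × P)
  label : T → Option ℕ

namespace PetriNet

variable {P T : Type*}

/-- The action emitted by a transition. -/
def action (N : PetriNet P T) (t : T) : Act :=
  match N.label t with
  | none => Act.tau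
  | some a => Act.act a

/-- A transition is enabled if all places with an edge to it hold a token. -/
def Enabled (N : PetriNet P T) (M : P → ℕ) (t : T) : Prop :=
  ∀ p, (p, t) ∈ N.inEdges → 1 ≤ M p

open Classical in
/-- The marking after firing `t` (which is meant to be enabled in `M`): one token is removed from
each place with an edge to `t`, and one is added to each place with an edge from `t`. -/
noncomputable def fire (N : PetriNet P T) (M : P → ℕ) (t : T) : P → ℕ := fun p =>
  (M p - if (p, t) ∈ N.inEdges then 1 else 0) + if (t, p) ∈ N.outEdges then 1 else 0

/-- `LTS(N, M₀)`. -/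
def toLTS (N : PetriNet P T) (M₀ : P → ℕ) : LTS where
  State := P → ℕ
  init := M₀
  tr M μ M' := ∃ t, N.Enabled M t ∧ N.action t = μ ∧ M' = N.fire M t

/-- The postset of a place. -/
def postset (N : PetriNet P T) (p : P) : Set T := {t | (p, t) ∈ N.inEdges}

/-- Group-choice nets: any two places have equal or disjoint postsets. -/
def IsGroupChoice (N : PetriNet P T) : Prop :=
  ∀ p q : P, N.postset p = N.postset q ∨ Disjoint (N.postset p) (N.postset q)

/-- The size `|N|`: number of places, transitions and edges. -/
def size [Fintype P] [Fintype T] (N : PetriNet P T) : ℕ :=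
  Fintype.card P + Fintype.card T + (N.inEdges.card + N.outEdges.card)

/-- An adjacency-list representation of a net: numberings of the places and of the transitions, and
for each place and each transition a list, in any order, of the targets of its outgoing edges. -/
structure AdjacencyList [Fintype P] [Fintype T] (N : PetriNet P T) where
  placeNo : P ≃ Fin (Fintype.card P)
  transNo : T ≃ Fin (Fintype.card T)
  placeOut : P → List T
  transOut : T → List P
  placeOut_nodup : ∀ p, (placeOut p).Nodup
  transOut_nodup : ∀ t, (transOut t).Nodup
  mem_placeOut : ∀ p t, t ∈ placeOut p ↔ (p, t) ∈ N.inEdges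
  mem_transOut : ∀ t p, p ∈ transOut t ↔ (t, p) ∈ N.outEdges

/-- The input of an encoding algorithm, as a list of numbers: the number of places; the number of
transitions; for each place its number of tokens, its number of outgoing edges and their
targets; for each transition its label (`0` for the internal action, `a + 1` for the visible
action `a`), its number of outgoing edges and their targets. -/
def AdjacencyList.write [Fintype P] [Fintype T] {N : PetriNet P T} (L : N.AdjacencyList)
    (M₀ : P → ℕ) : List ℕ :=
  Fintype.card P :: Fintype.card T ::
    ((List.finRange (Fintype.card P)).flatMap (fun i =>
        let p := L.placeNo.symm i
        M₀ p :: (L.placeOut p).length :: (L.placeOut p).map fun t => (L.transNo t : ℕ)) ++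
      (List.finRange (Fintype.card T)).flatMap (fun j =>
        let t := L.transNo.symm j
        (N.label t).elim 0 (fun a => a + 1) ::
          (L.transOut t).length :: (L.transOut t).map fun p => (L.placeNo p : ℕ)))

end PetriNet

/-! ## Unit-cost random access machines

Programs work on registers and arrays of natural numbers, both addressed by natural numbers; the
register and the array used by an instruction are fixed in the program (so that a program uses
finitely many), whereas the index into an array is computed.  Addition and truncated subtraction are
the only arithmetic operations; each operation costs one step. -/

namespace Ram

/-- Memory contents, and the output written so far. -/
structure Config where
  reg : ℕ → ℕ
  arr : ℕ → ℕ → ℕ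
  out : List ℕ

/-- Expressions: constants, registers, array cells, sums and truncated differences. -/
inductive Expr where
  | const (c : ℕ) : Expr
  | reg (x : ℕ) : Expr
  | get (A : ℕ) (e : Expr) : Expr
  | add (e e' : Expr) : Expr
  | sub (e e' : Expr) : Expr

/-- The value of an expression. -/
def Expr.eval (s : Config) : Expr → ℕ
  | .const c => c
  | .reg x => s.reg x
  | .get A e => s.arr A (e.eval s)
  | .add e e' => e.eval s + e'.eval s
  | .sub e e' => e.eval s - e'.eval s

/-- The number of steps needed to evaluate an expression. -/
def Expr.cost : Expr → ℕ
  | .const _ => 1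
  | .reg _ => 1
  | .get _ e => 1 + e.cost
  | .add e e' => 1 + e.cost + e'.cost
  | .sub e e' => 1 + e.cost + e'.cost

/-- Programs.  Conditions hold when the expression is nonzero. -/
inductive Prog where
  | skip : Prog
  | assign (x : ℕ) (e : Expr) : Prog
  | store (A : ℕ) (i e : Expr) : Prog
  | output (e : Expr) : Prog
  | seq (c c' : Prog) : Prog
  | ite (e : Expr) (c c' : Prog) : Prog
  | loop (e : Expr) (c : Prog) : Prog

/-- `Run c s s' n`: started in `s`, the program `c` halts in `s'` after exactly `n` steps. -/
inductive Run : Prog → Config → Config → ℕ → Prop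
  | skip (s : Config) : Run Prog.skip s s 1
  | assign (x : ℕ) (e : Expr) (s : Config) :
      Run (Prog.assign x e) s { s with reg := Function.update s.reg x (e.eval s) } (1 + e.cost)
  | store (A : ℕ) (i e : Expr) (s : Config) :
      Run (Prog.store A i e) s
        { s with arr := Function.update s.arr A (Function.update (s.arr A) (i.eval s) (e.eval s)) }
        (1 + i.cost + e.cost)
  | output (e : Expr) (s : Config) :
      Run (Prog.output e) s { s with out := s.out ++ [e.eval s] } (1 + e.cost)
  | seq {c c' : Prog} {s s' s'' : Config} {n n' : ℕ} :
      Run c s s' n → Run c' s' s'' n' → Run (Prog.seq c c') s s'' (n + n')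
  | ite_true {e : Expr} {c c' : Prog} {s s' : Config} {n : ℕ} :
      e.eval s ≠ 0 → Run c s s' n → Run (Prog.ite e c c') s s' (1 + e.cost + n)
  | ite_false {e : Expr} {c c' : Prog} {s s' : Config} {n : ℕ} :
      e.eval s = 0 → Run c' s s' n → Run (Prog.ite e c c') s s' (1 + e.cost + n)
  | loop_true {e : Expr} {c : Prog} {s s' s'' : Config} {n n' : ℕ} :
      e.eval s ≠ 0 → Run c s s' n → Run (Prog.loop e c) s' s'' n' →
      Run (Prog.loop e c) s s'' (1 + e.cost + n + n')
  | loop_false {e : Expr} {c : Prog} {s : Config} :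
      e.eval s = 0 → Run (Prog.loop e c) s s (1 + e.cost)

/-- The initial configuration: the input in array `0`, zeros elsewhere, and no output. -/
def start (input : List ℕ) : Config where
  reg _ := 0
  arr A i := if A = 0 then input.getD i 0 else 0
  out := []

/-- On the given input, the program halts after exactly `n` steps with the given output. -/
def Computes (c : Prog) (input output : List ℕ) (n : ℕ) : Prop :=
  ∃ s : Config, Run c (start input) s n ∧ s.out = output

end Ram

end NetToCCS

open NetToCCS

-- In a group-choice net the places with nonempty postset fall into groups with a common postset,
-- and the places with an edge to a given transition, if there are any, form exactly one group. The
-- tokens for a transition can therefore be collected one place at a time without commitment: any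
-- transition that could use a token held by a partial collector needs the whole group anyway.
--
-- Each group is ordered by place number. A token in its first place is a collector; a token in a
-- later place waits on a restricted channel belonging to that place. A collector synchronises with
-- a waiting token of the next place and becomes the collector of that place; the collector of the
-- last place offers the choice among the transitions of the group. Emitting a transition releases
-- the tokens on its outgoing edges. A transition without incoming edges is a component that
-- restores itself whenever it fires.
--
-- Up to restrictions and unfolding of names, a reachable process is a multiset of such components
-- (`Rep`, `Holds`). It stands for a marking (`mval`) in which a token held by a collector still
-- counts as lying in its place. Collecting preserves this marking (`val_collect`), and every other
-- step is a firing (`rstep_sound`). Conversely, an enabled transition can be emitted after some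
-- collecting (`collect_upto`, `rstep_complete`). Every collection lowers the number of components
-- by one, so that number bounds the internal steps without counterpart in the net. This yields an
-- expansion (`isExpansion`), from which weak bisimilarity and agreement on divergence both follow.
--
-- For linear time, the places are scanned in order while an array keeps, for each transition, the
-- last place seen with an edge to it. As postsets within a group agree, looking up one outgoing
-- edge of a place finds its predecessor in the group. The output is then written in further passes
-- over places and transitions (`wp_encoder`).

namespace NetToCCS

/-! ## Numbered nets -/

/-- A net and an initial marking in which places and transitions are numbered from zero. -/
structure NumNet where
  /-- number of places -/
  n : ℕ
  /-- number of transitions -/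
  m : ℕ
  /-- number of tokens of a place -/
  w : ℕ → ℕ
  /-- number of outgoing edges of a place -/
  d : ℕ → ℕ
  /-- targets of the outgoing edges of a place -/
  o : ℕ → ℕ → ℕ
  /-- label of a transition, `0` for the internal action and `a + 1` for the action `a` -/
  c : ℕ → ℕ
  /-- number of outgoing edges of a transition -/
  e : ℕ → ℕ
  /-- targets of the outgoing edges of a transition -/
  u : ℕ → ℕ → ℕ

namespace NumNet

/-- There is an edge from place `i` to transition `j`. -/
def Post (G : NumNet) (i j : ℕ) : Prop := ∃ k, k < G.d i ∧ G.o i k = j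

instance (G : NumNet) (i j : ℕ) : Decidable (G.Post i j) :=
  inferInstanceAs (Decidable (∃ k, k < G.d i ∧ G.o i k = j))

/-- The targets of the edges are numbers of places and transitions, no edge from a transition
occurs twice, and the places with an edge to
a common transition have edges to the same transitions. -/
structure Valid (G : NumNet) : Prop where
  o_lt : ∀ i < G.n, ∀ k < G.d i, G.o i k < G.m
  u_lt : ∀ j < G.m, ∀ k < G.e j, G.u j k < G.n
  u_inj : ∀ j < G.m, ∀ k < G.e j, ∀ k' < G.e j, G.u j k = G.u j k' → k = k'
  groupChoice : ∀ p < G.n, ∀ q < G.n, ∀ j, G.Post p j → G.Post q j →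
    ∀ j', G.Post p j' → G.Post q j'

/-- One plus the last place before `i` with an edge to `j`, or zero if there is none. -/
def lastAt (G : NumNet) : ℕ → ℕ → ℕ
  | 0, _ => 0
  | i + 1, j => if G.Post i j then i + 1 else G.lastAt i j

/-- One plus the last place before `i` with the same transitions as `i`, or zero. -/
def prev (G : NumNet) (i : ℕ) : ℕ := if G.d i = 0 then 0 else G.lastAt i (G.o i 0)

/-- One plus the last place `q` before `i` with `G.prev q = x`, or zero if there is none. -/
def nextAt (G : NumNet) : ℕ → ℕ → ℕ
  | 0, _ => 0
  | i + 1, x => if G.prev i = x then i + 1 else G.nextAt i x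

/-- One plus the last place with an edge to `j`, or zero if there is none. -/
def last (G : NumNet) (j : ℕ) : ℕ := G.lastAt G.n j

/-- One plus the place that follows `i` in its group, or zero if there is none. -/
def next (G : NumNet) (i : ℕ) : ℕ := G.nextAt G.n (i + 1)

/-- A number above all visible actions of the net. -/
def base (G : NumNet) : ℕ := ∑ j ∈ Finset.range G.m, G.c j

-- Predecessors and successors within a group of places

theorem lastAt_spec (G : NumNet) (i j : ℕ) :
    (G.lastAt i j = 0 ∧ ∀ p < i, ¬ G.Post p j) ∨
    ∃ p < i, G.lastAt i j = p + 1 ∧ G.Post p j ∧ ∀ q, p < q → q < i → ¬ G.Post q j := by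
  induction i with
  | zero => left; simp [lastAt]
  | succ i ih =>
    by_cases h : G.Post i j
    · right
      exact ⟨i, by omega, by simp [lastAt, h], h, fun q h1 h2 => by omega⟩
    · simp only [lastAt, h, if_false]
      rcases ih with ⟨h0, h1⟩ | ⟨p, hp, h0, h1, h2⟩
      · left
        refine ⟨h0, fun p hp => ?_⟩
        rcases Nat.lt_succ_iff_lt_or_eq.1 hp with hp | rfl
        exacts [h1 p hp, h]
      · right
        refine ⟨p, by omega, h0, h1, fun q hq hq' => ?_⟩
        rcases Nat.lt_succ_iff_lt_or_eq.1 hq' with hq' | rfl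
        exacts [h2 q hq hq', h]

theorem nextAt_spec (G : NumNet) (i x : ℕ) :
    (G.nextAt i x = 0 ∧ ∀ p < i, G.prev p ≠ x) ∨
    ∃ p < i, G.nextAt i x = p + 1 ∧ G.prev p = x := by
  induction i with
  | zero => left; simp [nextAt]
  | succ i ih =>
    by_cases h : G.prev i = x
    · right
      exact ⟨i, by omega, by simp [nextAt, h], h⟩
    · simp only [nextAt, h, if_false]
      rcases ih with ⟨h0, h1⟩ | ⟨p, hp, h0, h1⟩
      · left
        refine ⟨h0, fun p hp => ?_⟩
        rcases Nat.lt_succ_iff_lt_or_eq.1 hp with hp | rfl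
        exacts [h1 p hp, h]
      · exact Or.inr ⟨p, by omega, h0, h1⟩

/-- Two places have an edge to a common transition. -/
def Share (G : NumNet) (p q : ℕ) : Prop := ∃ j, G.Post p j ∧ G.Post q j

theorem Share.symm {G : NumNet} {p q : ℕ} (h : G.Share p q) : G.Share q p := by
  obtain ⟨j, h1, h2⟩ := h
  exact ⟨j, h2, h1⟩

theorem Valid.share_post {G : NumNet} (hG : G.Valid) {p q : ℕ} (hp : p < G.n) (hq : q < G.n)
    (h : G.Share p q) {j : ℕ} (hj : G.Post p j) : G.Post q j := by
  obtain ⟨j', h1, h2⟩ := h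
  exact hG.groupChoice p hp q hq j' h1 h2 j hj

theorem Valid.share_trans {G : NumNet} (hG : G.Valid) {p q r : ℕ} (hq : q < G.n)
    (hr : r < G.n) (h : G.Share p q) (h' : G.Share q r) : G.Share p r := by
  obtain ⟨j, h1, h2⟩ := h
  exact ⟨j, h1, hG.share_post hq hr h' h2⟩

theorem post_first (G : NumNet) {i : ℕ} (h : G.d i ≠ 0) : G.Post i (G.o i 0) :=
  ⟨0, by omega, rfl⟩

theorem last_eq_zero_iff (G : NumNet) (j : ℕ) :
    G.last j = 0 ↔ ∀ p < G.n, ¬ G.Post p j := by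
  rcases G.lastAt_spec G.n j with ⟨h0, h1⟩ | ⟨p, hp, h0, h1, _⟩
  · exact ⟨fun _ => h1, fun _ => h0⟩
  · constructor
    · intro h
      rw [last] at h
      omega
    · intro h
      exact absurd h1 (h p hp)

/-- `prev` inspects only the first outgoing edge of `q`. This suffices because a place that shares
one transition with `q` shares all of them. -/
theorem Valid.not_share_of_prev_eq_zero {G : NumNet} (hG : G.Valid) {q : ℕ} (hq : q < G.n)
    (h : G.prev q = 0) {p : ℕ} (hp : p < q) : ¬ G.Share p q := by
  intro hs
  by_cases hd : G.d q = 0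
  · obtain ⟨j, _, k, hk, _⟩ := hs
    omega
  · rw [prev, if_neg hd] at h
    rcases G.lastAt_spec q (G.o q 0) with ⟨_, h1⟩ | ⟨p', _, h0, _⟩
    · exact h1 p hp (hG.share_post hq (by omega) hs.symm (G.post_first hd))
    · omega

/-- A nonzero `prev` denotes the immediate predecessor in the group; values are shifted by one so
that zero can mean that there is none. -/
theorem Valid.of_prev_eq_succ {G : NumNet} (hG : G.Valid) {p q : ℕ} (hq : q < G.n)
    (h : G.prev q = p + 1) : p < q ∧ G.Share p q ∧ ∀ r, p < r → r < q → ¬ G.Share r q := by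
  have hd : G.d q ≠ 0 := fun hd => by simp [prev, hd] at h
  rw [prev, if_neg hd] at h
  rcases G.lastAt_spec q (G.o q 0) with ⟨h0, _⟩ | ⟨p', hp', h0, h1, h2⟩
  · omega
  · obtain rfl : p' = p := by omega
    refine ⟨hp', ⟨_, h1, G.post_first hd⟩, fun r h3 h4 hs => h2 r h3 h4 ?_⟩
    exact hG.share_post hq (by omega) hs.symm (G.post_first hd)

/-- Predecessors determine successors: if two places had the same immediate predecessor, they would
lie in one group, and the smaller would lie strictly between that predecessor and the larger. -/
theorem Valid.next_eq_succ_iff {G : NumNet} (hG : G.Valid) {p q : ℕ} :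
    G.next p = q + 1 ↔ q < G.n ∧ G.prev q = p + 1 := by
  rw [next]
  rcases G.nextAt_spec G.n (p + 1) with ⟨h0, h1⟩ | ⟨q', hq', h0, h1⟩
  · rw [h0]
    constructor
    · intro h
      omega
    · rintro ⟨h2, h3⟩
      exact absurd h3 (h1 q h2)
  · rw [h0]
    constructor
    · intro h
      obtain rfl : q' = q := by omega
      exact ⟨hq', h1⟩
    · rintro ⟨h2, h3⟩
      obtain ⟨ha, hb, hc⟩ := hG.of_prev_eq_succ hq' h1
      obtain ⟨ha', hb', hc'⟩ := hG.of_prev_eq_succ h2 h3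
      have hs : G.Share q q' := hG.share_trans (by omega) hq' hb'.symm hb
      rcases lt_trichotomy q q' with h | h | h
      · exact absurd hs (hc q ha' h)
      · rw [h]
      · exact absurd hs.symm (hc' q' ha h)

/-- A visible label `a` has code `a + 1`, so it lies strictly below `base`, and the channels `base +
i` are fresh. The sum of the codes serves as the bound because one addition per transition computes
it. -/
theorem code_le_base (G : NumNet) {j : ℕ} (hj : j < G.m) : G.c j ≤ G.base :=
  Finset.single_le_sum (f := G.c) (fun _ _ => Nat.zero_le _) (Finset.mem_range.2 hj)

/-! ## The encoding -/

/-- The action with the given code. -/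
def _root_.NetToCCS.Act.ofCode (c : ℕ) : Act := if c = 0 then Act.tau else Act.act (c - 1)

/-- Parallel composition of a list of processes. -/
def _root_.NetToCCS.Proc.parList (l : List Proc) : Proc := l.foldr Proc.par (Proc.seq SeqProc.nil)

/-- Sum of a list of sequential processes. -/
def _root_.NetToCCS.SeqProc.sumList (l : List SeqProc) : SeqProc :=
  l.foldr SeqProc.sum SeqProc.nil

/-- Restriction of a list of actions. -/
def _root_.NetToCCS.Proc.resList (l : List ℕ) (Q : Proc) : Proc := l.foldr Proc.res Q

/-- A token in place `i`. -/
def token (G : NumNet) (i : ℕ) : Proc :=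
  if G.prev i = 0 then Proc.name i
  else Proc.seq (SeqProc.pre (Act.co (G.base + i)) (Proc.seq SeqProc.nil))

/-- The emission of transition `j`. -/
def emit (G : NumNet) (j : ℕ) : SeqProc :=
  SeqProc.pre (Act.ofCode (G.c j)) (Proc.name (G.n + j))

/-- A transition without incoming edges. -/
def sources (G : NumNet) (j : ℕ) : List Proc :=
  if G.last j = 0 then [Proc.seq (G.emit j)] else []

/-- The process that holds a token for `i` and each place before `i` in its group. -/
def collector (G : NumNet) (i : ℕ) : Proc :=
  Proc.seq <| if G.next i = 0
    then SeqProc.sumList ((List.range (G.d i)).map fun k => G.emit (G.o i k))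
    else SeqProc.pre (Act.act (G.base + (G.next i - 1))) (Proc.name (G.next i - 1))

/-- The process that starts when transition `j` has been fired. -/
def product (G : NumNet) (j : ℕ) : Proc :=
  Proc.parList (G.sources j ++ (List.range (G.e j)).map fun k => G.token (G.u j k))

/-- The tokens of the initial marking and the transitions without incoming edges. -/
def initial (G : NumNet) : List Proc :=
  ((List.range G.n).flatMap fun i => (List.range (G.w i)).map fun _ => G.token i) ++
    (List.range G.m).flatMap G.sources

/-- The channels used for collecting tokens. -/
def channels (G : NumNet) : List ℕ := (List.range G.n).map (G.base + ·)

/-- The CCS process with defining equations for a numbered net. -/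
def encode (G : NumNet) : CCSSystem where
  proc := Proc.resList G.channels (Proc.parList G.initial)
  eqs := ((List.range G.n).map fun i => (i, G.collector i)) ++
    (List.range G.m).map fun j => (G.n + j, G.product j)

theorem encode_wellFormed (G : NumNet) : G.encode.WellFormed := by
  simp only [CCSSystem.WellFormed, encode, List.map_append, List.map_map]
  refine List.Nodup.append ?_ ?_ ?_
  · exact List.nodup_range.map fun a b h => h
  · exact List.nodup_range.map fun a b h => by simpa using h
  · intro x h1 h2
    -- Names of places are below `n`, names of transitions at least `n`.
    simp at h1 h2
    omega

theorem _root_.List.lookup_eq_some_of_mem {α β : Type*} [BEq α] [LawfulBEq α] {l : List (α × β)}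
    (hl : (l.map Prod.fst).Nodup) {a : α} {b : β} (h : (a, b) ∈ l) : l.lookup a = some b := by
  induction l with
  | nil => simp at h
  | cons x l ih =>
    rcases x with ⟨a', b'⟩
    simp only [List.map_cons, List.nodup_cons] at hl
    rcases List.mem_cons.1 h with h' | h'
    · cases h'
      simp [List.lookup]
    · have : a ≠ a' := by
        rintro rfl
        exact hl.1 (List.mem_map_of_mem (f := Prod.fst) h')
      simp only [List.lookup, beq_eq_false_iff_ne.2 this]
      exact ih hl.2 h'

theorem defs_place (G : NumNet) {i : ℕ} (hi : i < G.n) : G.encode.defs i = some (G.collector i) :=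
  List.lookup_eq_some_of_mem G.encode_wellFormed (by simp [encode, hi])

theorem defs_trans (G : NumNet) {j : ℕ} (hj : j < G.m) :
    G.encode.defs (G.n + j) = some (G.product j) :=
  List.lookup_eq_some_of_mem G.encode_wellFormed (by simp [encode, hj])

/-! ### Size -/

theorem size_parList_le {k : ℕ} {l : List Proc} (h : ∀ Q ∈ l, Q.size ≤ k) :
    (Proc.parList l).size ≤ (k + 1) * l.length + 1 := by
  induction l with
  | nil => simp [Proc.parList, Proc.size, SeqProc.size]
  | cons Q l ih =>
    have h1 := ih fun Q hQ => h Q (List.mem_cons_of_mem _ hQ)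
    have h2 := h Q List.mem_cons_self
    simp only [Proc.parList, List.foldr_cons, Proc.size, List.length_cons] at h1 ⊢
    linarith

theorem size_sumList_le {k : ℕ} {l : List SeqProc} (h : ∀ Q ∈ l, Q.size ≤ k) :
    (SeqProc.sumList l).size ≤ (k + 1) * l.length + 1 := by
  induction l with
  | nil => simp [SeqProc.sumList, SeqProc.size]
  | cons Q l ih =>
    have h1 := ih fun Q hQ => h Q (List.mem_cons_of_mem _ hQ)
    have h2 := h Q List.mem_cons_self
    simp only [SeqProc.sumList, List.foldr_cons, SeqProc.size, List.length_cons] at h1 ⊢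
    linarith

theorem size_resList (l : List ℕ) (Q : Proc) : (Proc.resList l Q).size = l.length + Q.size := by
  induction l with
  | nil => simp [Proc.resList]
  | cons a l ih =>
    simp only [Proc.resList, List.foldr_cons, Proc.size, List.length_cons] at ih ⊢
    omega

theorem size_token_le (G : NumNet) (i : ℕ) : (G.token i).size ≤ 2 := by
  unfold token
  split <;> simp [Proc.size, SeqProc.size]

theorem size_emit (G : NumNet) (j : ℕ) : (G.emit j).size = 2 := by
  simp [emit, Proc.size, SeqProc.size]

theorem length_sources_le (G : NumNet) (j : ℕ) : (G.sources j).length ≤ 1 := by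
  unfold sources
  split <;> simp

theorem size_of_mem_sources (G : NumNet) {j : ℕ} {Q : Proc} (h : Q ∈ G.sources j) :
    Q.size ≤ 2 := by
  unfold sources at h
  split at h <;> simp at h
  simp [h, Proc.size, size_emit]

theorem size_collector_le (G : NumNet) (i : ℕ) : (G.collector i).size ≤ 3 * G.d i + 2 := by
  unfold collector
  split
  · have := size_sumList_le (k := 2) (l := (List.range (G.d i)).map fun k => G.emit (G.o i k)) (by
      simp [size_emit])
    simp only [List.length_map, List.length_range] at this
    simp only [Proc.size]
    omega
  · simp [Proc.size, SeqProc.size]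

theorem size_product_le (G : NumNet) (j : ℕ) : (G.product j).size ≤ 3 * G.e j + 4 := by
  have := size_parList_le (k := 2)
    (l := G.sources j ++ (List.range (G.e j)).map fun k => G.token (G.u j k)) (by
      intro Q hQ
      rcases List.mem_append.1 hQ with hQ | hQ
      · exact G.size_of_mem_sources hQ
      · obtain ⟨k, _, rfl⟩ := List.mem_map.1 hQ
        exact G.size_token_le _)
  have h := G.length_sources_le j
  simp only [List.length_append, List.length_map, List.length_range] at this
  unfold product
  omega

/-- The size of a numbered net with its marking. -/
def total (G : NumNet) : ℕ :=
  G.n + G.m + ∑ i ∈ Finset.range G.n, G.d i + ∑ j ∈ Finset.range G.m, G.e j +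
    ∑ i ∈ Finset.range G.n, G.w i

theorem sum_map_range (n : ℕ) (f : ℕ → ℕ) :
    ((List.range n).map f).sum = ∑ i ∈ Finset.range n, f i := by
  induction n with
  | zero => simp
  | succ n ih => simp [List.range_succ, Finset.sum_range_succ, ih]

/-- The restrictions contribute `n`, the initial components `3 * (∑ w + m) + 1`, the equations `3 *
∑ d + 3 * n` and `3 * ∑ e + 5 * m`. The largest total coefficient is 8, that of `m`. -/
theorem encode_size_le (G : NumNet) : G.encode.size ≤ 9 * (G.total + 1) := by
  have h1 := size_parList_le (k := 2) (l := G.initial) (by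
      intro Q hQ
      rcases List.mem_append.1 hQ with hQ | hQ
      · obtain ⟨i, _, hQ⟩ := List.mem_flatMap.1 hQ
        obtain ⟨k, _, rfl⟩ := List.mem_map.1 hQ
        exact G.size_token_le _
      · obtain ⟨i, _, hQ⟩ := List.mem_flatMap.1 hQ
        exact G.size_of_mem_sources hQ)
  have h2 : G.initial.length ≤ ∑ i ∈ Finset.range G.n, G.w i + G.m := by
    simp only [initial, List.length_append, List.length_flatMap, List.length_map,
      List.length_range, sum_map_range]
    gcongr
    calc _ ≤ ∑ j ∈ Finset.range G.m, 1 := Finset.sum_le_sum fun j _ => G.length_sources_le j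
      _ = _ := by simp
  have h3 : ∑ i ∈ Finset.range G.n, (1 + (G.collector i).size) ≤
      3 * ∑ i ∈ Finset.range G.n, G.d i + 3 * G.n := by
    calc _ ≤ ∑ i ∈ Finset.range G.n, (3 * G.d i + 3) :=
          Finset.sum_le_sum fun i _ => by have := G.size_collector_le i; omega
      _ = _ := by simp [Finset.sum_add_distrib, ← Finset.mul_sum, mul_comm]
  have h4 : ∑ j ∈ Finset.range G.m, (1 + (G.product j).size) ≤
      3 * ∑ j ∈ Finset.range G.m, G.e j + 5 * G.m := by
    calc _ ≤ ∑ j ∈ Finset.range G.m, (3 * G.e j + 5) :=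
          Finset.sum_le_sum fun j _ => by have := G.size_product_le j; omega
      _ = _ := by simp [Finset.sum_add_distrib, ← Finset.mul_sum, mul_comm]
  simp only [CCSSystem.size, encode, size_resList, channels, List.length_map, List.length_range,
    List.map_append, List.map_map, List.sum_append, Function.comp_def, sum_map_range, total]
  omega

/-! ## Processes as multisets of tokens -/

/-- The components of a reachable process. -/
inductive Tok where
  /-- the collector `i` -/
  | body (i : ℕ) : Tok
  /-- a token that waits to be collected -/
  | wait (i : ℕ) : Tok
  /-- a transition without incoming edges -/
  | src (j : ℕ) : Tok

open Tok

/-- The component for a token in place `i`. -/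
def tok (G : NumNet) (i : ℕ) : Tok := if G.prev i = 0 then body i else wait i

/-- The components that restart when transition `j` has been fired. -/
def srcs (G : NumNet) (j : ℕ) : Multiset Tok := if G.last j = 0 then {src j} else 0

/-- The components that start when transition `j` has been fired. -/
def yield (G : NumNet) (j : ℕ) : Multiset Tok :=
  G.srcs j + ((Multiset.range (G.e j)).map fun k => G.tok (G.u j k))

/-- The process is a parallel composition of the given components. -/
inductive Holds (G : NumNet) : Proc → Multiset Tok → Prop
  | nil : Holds G (Proc.seq SeqProc.nil) 0
  | par {Q Q' : Proc} {m m' : Multiset Tok} : Holds G Q m → Holds G Q' m' →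
      Holds G (Proc.par Q Q') (m + m')
  | body (i : ℕ) : i < G.n → Holds G (Proc.name i) {body i}
  | wait (i : ℕ) : i < G.n → Holds G
      (Proc.seq (SeqProc.pre (Act.co (G.base + i)) (Proc.seq SeqProc.nil))) {wait i}
  | src (j : ℕ) : j < G.m → Holds G (Proc.seq (G.emit j)) {src j}
  | name (j : ℕ) (m : Multiset Tok) : j < G.m → Holds G (G.product j) m →
      Holds G (Proc.name (G.n + j)) m

/-- Transitions of components. -/
inductive TokStep (G : NumNet) : Tok → Act → Multiset Tok → Prop
  | collect (i q : ℕ) : i < G.n → G.next i = q + 1 →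
      TokStep G (body i) (Act.act (G.base + q)) {body q}
  | fire (i j : ℕ) : i < G.n → G.next i = 0 → G.Post i j →
      TokStep G (body i) (Act.ofCode (G.c j)) (G.yield j)
  | wait (i : ℕ) : TokStep G (wait i) (Act.co (G.base + i)) 0
  | src (j : ℕ) : j < G.m → TokStep G (src j) (Act.ofCode (G.c j)) (G.yield j)

/-- Transitions of multisets of components. -/
inductive MStep (G : NumNet) : Multiset Tok → Act → Multiset Tok → Prop
  | single {x : Tok} {μ : Act} {new : Multiset Tok} (r : Multiset Tok) : TokStep G x μ new →
      MStep G (x ::ₘ r) μ (r + new)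
  | double {x y : Tok} {a : ℕ} {new new' : Multiset Tok} (r : Multiset Tok) :
      TokStep G x (Act.act a) new → TokStep G y (Act.co a) new' →
      MStep G (x ::ₘ y ::ₘ r) Act.tau (r + new + new')

theorem MStep.add_right {G : NumNet} {m m' : Multiset Tok} {μ : Act} (h : MStep G m μ m')
    (s : Multiset Tok) : MStep G (m + s) μ (m' + s) := by
  cases h with
  | single r h =>
    rw [Multiset.cons_add, add_right_comm]
    exact MStep.single _ h
  | double r h h' =>
    rw [Multiset.cons_add, Multiset.cons_add, add_right_comm, add_right_comm r]
    exact MStep.double _ h h'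

theorem MStep.add_left {G : NumNet} {m m' : Multiset Tok} {μ : Act} (h : MStep G m μ m')
    (s : Multiset Tok) : MStep G (s + m) μ (s + m') := by
  rw [add_comm s, add_comm s]
  exact h.add_right s

theorem MStep.visible {G : NumNet} {m m' : Multiset Tok} {μ : Act} (h : MStep G m μ m')
    (hμ : μ ≠ Act.tau) : ∃ x r new, TokStep G x μ new ∧ m = x ::ₘ r ∧ m' = r + new := by
  cases h with
  | single r h => exact ⟨_, _, _, h, rfl, rfl⟩
  | double r h h' => exact absurd rfl hμ

/-- Synchronisation across a parallel composition: a visible step comes from a single component, so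
one component on each side takes part. -/
theorem MStep.double_of_add {G : NumNet} {m₁ m₂ m₁' m₂' : Multiset Tok} {a : ℕ}
    (h₁ : MStep G m₁ (Act.act a) m₁') (h₂ : MStep G m₂ (Act.co a) m₂') :
    MStep G (m₁ + m₂) Act.tau (m₁' + m₂') := by
  obtain ⟨x, r, new, h, rfl, rfl⟩ := h₁.visible (by simp)
  obtain ⟨y, s, new', h', rfl, rfl⟩ := h₂.visible (by simp)
  have := MStep.double (r + s) h h'
  convert this using 1
  · simp [Multiset.cons_swap]
  · abel

theorem Holds.parList_append {G : NumNet} {l l' : List Proc} {m m' : Multiset Tok}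
    (h : Holds G (Proc.parList l) m) (h' : Holds G (Proc.parList l') m') :
    Holds G (Proc.parList (l ++ l')) (m + m') := by
  induction l generalizing m with
  | nil =>
    cases h
    simpa using h'
  | cons Q l ih =>
    cases h with
    | par h1 h2 =>
      rw [add_assoc]
      exact Holds.par h1 (ih h2)

theorem Holds.singleton {G : NumNet} {Q : Proc} {m : Multiset Tok} (h : Holds G Q m) :
    Holds G (Proc.parList [Q]) m := by
  have := Holds.par h Holds.nil
  rwa [add_zero] at this

theorem holds_token (G : NumNet) {i : ℕ} (hi : i < G.n) : Holds G (G.token i) {G.tok i} := by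
  unfold token tok
  split
  · exact Holds.body i hi
  · exact Holds.wait i hi

theorem holds_sources (G : NumNet) {j : ℕ} (hj : j < G.m) :
    Holds G (Proc.parList (G.sources j)) (G.srcs j) := by
  unfold sources srcs
  split
  · exact (Holds.src j hj).singleton
  · exact Holds.nil

theorem holds_tokens (G : NumNet) (k : ℕ) (f : ℕ → ℕ) (hf : ∀ i < k, f i < G.n) :
    Holds G (Proc.parList ((List.range k).map fun i => G.token (f i)))
      ((Multiset.range k).map fun i => G.tok (f i)) := by
  induction k with
  | zero => exact Holds.nil
  | succ k ih =>
    rw [List.range_succ, List.map_append, Multiset.range_succ, Multiset.map_cons,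
      ← Multiset.singleton_add, add_comm]
    exact (ih fun i hi => hf i (by omega)).parList_append (G.holds_token (hf k (by omega))).singleton

theorem Valid.holds_product {G : NumNet} (hG : G.Valid) {j : ℕ} (hj : j < G.m) :
    Holds G (G.product j) (G.yield j) :=
  (G.holds_sources hj).parList_append (G.holds_tokens _ _ (hG.u_lt j hj))

/-- The components of the initial process. -/
def start (G : NumNet) : Multiset Tok :=
  (∑ i ∈ Finset.range G.n, Multiset.replicate (G.w i) (G.tok i)) +
    ∑ j ∈ Finset.range G.m, G.srcs j

theorem holds_flatMap (G : NumNet) (k : ℕ) (f : ℕ → List Proc) (g : ℕ → Multiset Tok)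
    (h : ∀ i < k, Holds G (Proc.parList (f i)) (g i)) :
    Holds G (Proc.parList ((List.range k).flatMap f)) (∑ i ∈ Finset.range k, g i) := by
  induction k with
  | zero => exact Holds.nil
  | succ k ih =>
    rw [List.range_succ, List.flatMap_append, Finset.sum_range_succ]
    exact (ih fun i hi => h i (by omega)).parList_append (by simpa using h k (by omega))

theorem holds_initial (G : NumNet) : Holds G (Proc.parList G.initial) G.start := by
  refine (G.holds_flatMap _ _ _ fun i hi => ?_).parList_append
    (G.holds_flatMap _ _ _ fun j hj => G.holds_sources hj)
  have := G.holds_tokens (G.w i) (fun _ => i) fun _ _ => hi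
  rwa [Multiset.map_const', Multiset.card_range] at this

-- Steps of processes correspond to steps of multisets

theorem seqStep_sumList {l : List SeqProc} {μ : Act} {Q : Proc} :
    SeqStep (SeqProc.sumList l) μ Q ↔ ∃ P ∈ l, SeqStep P μ Q := by
  induction l with
  | nil =>
    simp only [SeqProc.sumList, List.foldr_nil, List.not_mem_nil, false_and, exists_false,
      iff_false]
    intro h
    cases h
  | cons P l ih =>
    simp only [List.mem_cons, exists_eq_or_imp, ← ih]
    constructor
    · intro h
      cases h with
      | sum1 h => exact Or.inl h
      | sum2 h => exact Or.inr h
    · rintro (h | h)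
      · exact SeqStep.sum1 h
      · exact SeqStep.sum2 h

theorem step_collector (G : NumNet) (i : ℕ) {D : ℕ → Option Proc} {μ : Act} {Q : Proc} :
    Step D (G.collector i) μ Q ↔
      (∃ q, G.next i = q + 1 ∧ μ = Act.act (G.base + q) ∧ Q = Proc.name q) ∨
      (G.next i = 0 ∧ ∃ j, G.Post i j ∧ μ = Act.ofCode (G.c j) ∧ Q = Proc.name (G.n + j)) := by
  have key : Step D (G.collector i) μ Q ↔ SeqStep (if G.next i = 0
    then SeqProc.sumList ((List.range (G.d i)).map fun k => G.emit (G.o i k))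
    else SeqProc.pre (Act.act (G.base + (G.next i - 1))) (Proc.name (G.next i - 1))) μ Q := by
    constructor
    · intro h
      cases h with
      | seq h => exact h
    · exact Step.seq
  rw [key]
  split
  · rename_i h0
    rw [seqStep_sumList]
    simp only [h0, true_and, List.mem_map, List.mem_range]
    constructor
    · rintro ⟨_, ⟨k, hk, rfl⟩, h⟩
      right
      refine ⟨_, ⟨k, hk, rfl⟩, ?_⟩
      cases h
      exact ⟨rfl, rfl⟩
    · rintro (⟨q, h, _⟩ | ⟨_, ⟨k, hk, rfl⟩, rfl, rfl⟩)
      · omega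
      · exact ⟨_, ⟨k, hk, rfl⟩, SeqStep.pref _ _⟩
  · rename_i h0
    constructor
    · intro h
      left
      cases h
      exact ⟨G.next i - 1, by omega, rfl, rfl⟩
    · rintro (⟨q, h, rfl, rfl⟩ | ⟨h, _⟩)
      · rw [h]
        exact SeqStep.pref _ _
      · omega

theorem Valid.post_lt {G : NumNet} (hG : G.Valid) {i j : ℕ} (hi : i < G.n) (h : G.Post i j) :
    j < G.m := by
  obtain ⟨k, hk, rfl⟩ := h
  exact hG.o_lt i hi k hk

/-- The multiset forgets the tree shape of the parallel composition and its inactive leaves.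
Unfolding a name is part of the step that follows it, so the name of a fired transition already
counts as the components that it releases. -/
theorem Valid.mstep_of_step {G : NumNet} (hG : G.Valid) {Q Q' : Proc} {m : Multiset Tok} {μ : Act}
    (h : Holds G Q m) (hs : Step G.encode.defs Q μ Q') : ∃ m', Holds G Q' m' ∧ MStep G m μ m' := by
  induction h generalizing μ Q' with
  | nil =>
    cases hs with
    | seq h => cases h
  | par h1 h2 ih1 ih2 =>
    cases hs with
    | par1 hs =>
      obtain ⟨m', h, h'⟩ := ih1 hs
      exact ⟨_, Holds.par h h2, h'.add_right _⟩
    | par2 hs =>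
      obtain ⟨m', h, h'⟩ := ih2 hs
      exact ⟨_, Holds.par h1 h, h'.add_left _⟩
    | com1 hs hs' =>
      obtain ⟨m₁, h, h'⟩ := ih1 hs
      obtain ⟨m₂, k, k'⟩ := ih2 hs'
      exact ⟨_, Holds.par h k, h'.double_of_add k'⟩
    | com2 hs hs' =>
      obtain ⟨m₁, h, h'⟩ := ih1 hs
      obtain ⟨m₂, k, k'⟩ := ih2 hs'
      refine ⟨_, Holds.par h k, ?_⟩
      rw [add_comm, add_comm m₁]
      exact k'.double_of_add h'
  | body i hi =>
    cases hs with
    | cons hD hs =>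
      rw [G.defs_place hi] at hD
      cases hD
      rcases (G.step_collector i).1 hs with ⟨q, h1, rfl, rfl⟩ | ⟨h1, j, h2, rfl, rfl⟩
      · refine ⟨{body q}, Holds.body q (hG.next_eq_succ_iff.1 h1).1, ?_⟩
        simpa using MStep.single 0 (TokStep.collect i q hi h1)
      · have hj := hG.post_lt hi h2
        refine ⟨G.yield j, Holds.name j _ hj (hG.holds_product hj), ?_⟩
        simpa using MStep.single 0 (TokStep.fire i j hi h1 h2)
  | wait i hi =>
    cases hs with
    | seq h =>
      cases h
      exact ⟨0, Holds.nil, by simpa using MStep.single 0 (TokStep.wait (G := G) i)⟩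
  | src j hj =>
    cases hs with
    | seq h =>
      cases h
      refine ⟨G.yield j, Holds.name j _ hj (hG.holds_product hj), ?_⟩
      simpa using MStep.single 0 (TokStep.src j hj)
  | name j m hj _ ih =>
    cases hs with
    | cons hD hs =>
      rw [G.defs_trans hj] at hD
      cases hD
      exact ih hs

/-- The components that act are located in the tree of parallel compositions; two synchronising
components lie in the same subtree or are separated by the current `par`. -/
theorem Valid.step_of_mstep {G : NumNet} (hG : G.Valid) {Q : Proc} {m m' : Multiset Tok} {μ : Act}
    (h : Holds G Q m) (hs : MStep G m μ m') :
    ∃ Q', Step G.encode.defs Q μ Q' ∧ Holds G Q' m' := by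
  -- A leaf of the tree is a single component, which cannot synchronise with itself.
  have leaf : ∀ {t : Tok} {μ : Act} {m' : Multiset Tok}, MStep G {t} μ m' → TokStep G t μ m' := by
    intro t μ m' h
    generalize hm : ({t} : Multiset Tok) = m at h
    cases h with
    | single r h =>
      obtain ⟨rfl, rfl⟩ := (Multiset.cons_eq_cons.1 (hm : t ::ₘ 0 = _)).resolve_right (by
        rintro ⟨_, _, h, _⟩
        exact absurd h.symm (Multiset.cons_ne_zero))
      simpa using h
    | double r h h' =>
      have := congrArg Multiset.card hm
      simp at this
  induction h generalizing μ m' with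
  | nil =>
    generalize hm : (0 : Multiset Tok) = m at hs
    cases hs with
    | single r h => exact absurd hm.symm Multiset.cons_ne_zero
    | double r h h' => exact absurd hm.symm Multiset.cons_ne_zero
  | @par Q₁ Q₂ m₁ m₂ h1 h2 ih1 ih2 =>
    generalize hm : m₁ + m₂ = m at hs
    -- A component of a sum of multisets belongs to one of the summands, and is removed there.
    have split : ∀ {x : Tok} {r m₁ m₂ : Multiset Tok}, m₁ + m₂ = x ::ₘ r →
        (∃ r₁, m₁ = x ::ₘ r₁ ∧ r = r₁ + m₂) ∨ ∃ r₂, m₂ = x ::ₘ r₂ ∧ r = m₁ + r₂ := by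
      intro x r m₁ m₂ h
      have hx : x ∈ m₁ + m₂ := h ▸ Multiset.mem_cons_self _ _
      rcases Multiset.mem_add.1 hx with hx | hx
      · obtain ⟨r₁, rfl⟩ := Multiset.exists_cons_of_mem hx
        left
        refine ⟨r₁, rfl, ?_⟩
        simpa using h.symm
      · obtain ⟨r₂, rfl⟩ := Multiset.exists_cons_of_mem hx
        right
        refine ⟨r₂, rfl, ?_⟩
        simpa using h.symm
    cases hs with
    | single r h =>
      rcases split hm with ⟨r₁, rfl, rfl⟩ | ⟨r₂, rfl, rfl⟩
      · obtain ⟨Q', hQ, hQ'⟩ := ih1 (MStep.single _ h)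
        exact ⟨_, Step.par1 hQ, by rw [add_right_comm]; exact Holds.par hQ' h2⟩
      · obtain ⟨Q', hQ, hQ'⟩ := ih2 (MStep.single _ h)
        exact ⟨_, Step.par2 hQ, by rw [add_assoc]; exact Holds.par h1 hQ'⟩
    | double r h h' =>
      rcases split hm with ⟨r₁, rfl, hr⟩ | ⟨r₂, rfl, hr⟩
      · rcases split hr.symm with ⟨r₂, rfl, rfl⟩ | ⟨r₂, rfl, rfl⟩
        · obtain ⟨Q', hQ, hQ'⟩ := ih1 (MStep.double _ h h')
          refine ⟨_, Step.par1 hQ, ?_⟩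
          convert Holds.par hQ' h2 using 1
          abel
        · obtain ⟨Q', hQ, hQ'⟩ := ih1 (MStep.single _ h)
          obtain ⟨Q'', hP, hP'⟩ := ih2 (MStep.single _ h')
          refine ⟨_, Step.com1 hQ hP, ?_⟩
          convert Holds.par hQ' hP' using 1
          abel
      · rcases split hr.symm with ⟨r₁, rfl, rfl⟩ | ⟨r₁, rfl, rfl⟩
        · obtain ⟨Q', hQ, hQ'⟩ := ih2 (MStep.single _ h)
          obtain ⟨Q'', hP, hP'⟩ := ih1 (MStep.single _ h')
          refine ⟨_, Step.com2 hP hQ, ?_⟩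
          convert Holds.par hP' hQ' using 1
          abel
        · obtain ⟨Q', hQ, hQ'⟩ := ih2 (MStep.double _ h h')
          refine ⟨_, Step.par2 hQ, ?_⟩
          convert Holds.par h1 hQ' using 1
          abel
  | body i hi =>
    cases leaf hs with
    | collect _ q _ h =>
      exact ⟨_, Step.cons (G.defs_place hi) ((G.step_collector i).2 (Or.inl ⟨q, h, rfl, rfl⟩)),
        Holds.body q (hG.next_eq_succ_iff.1 h).1⟩
    | fire _ j _ h h' =>
      exact ⟨_, Step.cons (G.defs_place hi) ((G.step_collector i).2 (Or.inr ⟨h, j, h', rfl, rfl⟩)),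
        Holds.name j _ (hG.post_lt hi h') (hG.holds_product (hG.post_lt hi h'))⟩
  | wait i hi =>
    cases leaf hs
    exact ⟨_, Step.seq (SeqStep.pref _ _), Holds.nil⟩
  | src j hj =>
    cases leaf hs
    exact ⟨_, Step.seq (SeqStep.pref _ _), Holds.name j _ hj (hG.holds_product hj)⟩
  | name j m hj _ ih =>
    obtain ⟨Q', h, h'⟩ := ih hs
    exact ⟨Q', Step.cons (G.defs_trans hj) h, h'⟩

/-! ### Restriction of the channels -/

theorem step_resList {D : ℕ → Option Proc} {l : List ℕ} {Q R : Proc} {μ : Act} :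
    Step D (Proc.resList l Q) μ R ↔ ∃ Q', R = Proc.resList l Q' ∧ Step D Q μ Q' ∧
      ∀ a ∈ l, μ ≠ Act.act a ∧ μ ≠ Act.co a := by
  induction l generalizing R with
  | nil => simp [Proc.resList]
  | cons a l ih =>
    have hc : ∀ Q, Proc.resList (a :: l) Q = Proc.res a (Proc.resList l Q) := fun _ => rfl
    simp only [hc, List.forall_mem_cons]
    constructor
    · intro h
      cases h with
      | res h h1 h2 =>
        obtain ⟨Q', rfl, h3, h4⟩ := ih.1 h
        exact ⟨Q', rfl, h3, ⟨h1, h2⟩, h4⟩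
    · rintro ⟨Q', rfl, h3, ⟨h1, h2⟩, h4⟩
      exact Step.res (ih.2 ⟨Q', rfl, h3, h4⟩) h1 h2

/-- Transitions of multisets of components that are not blocked by the restrictions. -/
inductive RStep (G : NumNet) : Multiset Tok → Act → Multiset Tok → Prop
  | collect (p q : ℕ) (r : Multiset Tok) : p < G.n → G.next p = q + 1 →
      RStep G (body p ::ₘ wait q ::ₘ r) Act.tau (body q ::ₘ r)
  | fire (i j : ℕ) (r : Multiset Tok) : i < G.n → G.next i = 0 → G.Post i j →
      RStep G (body i ::ₘ r) (Act.ofCode (G.c j)) (r + G.yield j)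
  | src (j : ℕ) (r : Multiset Tok) : j < G.m →
      RStep G (src j ::ₘ r) (Act.ofCode (G.c j)) (r + G.yield j)

theorem ofCode_ne_act (G : NumNet) {j : ℕ} (hj : j < G.m) (i : ℕ) :
    Act.ofCode (G.c j) ≠ Act.act (G.base + i) := by
  have := G.code_le_base hj
  unfold Act.ofCode
  split
  · simp
  · simp only [ne_eq, Act.act.injEq]
    omega

theorem ofCode_ne_co (c a : ℕ) : Act.ofCode c ≠ Act.co a := by
  unfold Act.ofCode
  split <;> simp

/-- Restriction leaves only synchronisations on channels and emissions of labels; labels cannot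
synchronise, since they are never co-actions and differ from all channels. The hypothesis `hm`
ensures that the channel of each waiting token is among the restricted ones. -/
theorem Valid.rstep_iff {G : NumNet} (hG : G.Valid) {m m' : Multiset Tok} {μ : Act}
    (hm : ∀ i, wait i ∈ m → i < G.n) :
    RStep G m μ m' ↔ MStep G m μ m' ∧ ∀ a ∈ G.channels, μ ≠ Act.act a ∧ μ ≠ Act.co a := by
  simp only [channels, List.forall_mem_map, List.mem_range]
  constructor
  · intro h
    cases h with
    | collect p q r hp h =>
      refine ⟨?_, by simp⟩
      have := MStep.double r (TokStep.collect p q hp h) (TokStep.wait q)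
      rwa [add_zero, add_comm, Multiset.singleton_add] at this
    | fire i j r hi h h' =>
      exact ⟨MStep.single r (TokStep.fire i j hi h h'), fun a _ =>
        ⟨G.ofCode_ne_act (hG.post_lt hi h') a, ofCode_ne_co _ _⟩⟩
    | src j r hj =>
      exact ⟨MStep.single r (TokStep.src j hj), fun a _ =>
        ⟨G.ofCode_ne_act hj a, ofCode_ne_co _ _⟩⟩
  · rintro ⟨h, hμ⟩
    cases h with
    | single r h =>
      cases h with
      | collect i q hi h => exact absurd rfl (hμ q (hG.next_eq_succ_iff.1 h).1).1
      | fire i j hi h h' => exact RStep.fire i j r hi h h'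
      | wait i => exact absurd rfl (hμ i (hm i (Multiset.mem_cons_self _ _))).2
      | src j hj => exact RStep.src j r hj
    | @double x y a new new' r h h' =>
      generalize hb : Act.co a = b at h'
      cases h' with
      | collect => cases hb
      | fire => exact absurd hb.symm (ofCode_ne_co _ _)
      | src => exact absurd hb.symm (ofCode_ne_co _ _)
      | wait q =>
        cases hb
        generalize hb : Act.act (G.base + q) = b at h
        cases h with
        | collect p q' hp h =>
          simp only [Act.act.injEq, Nat.add_left_cancel_iff] at hb
          subst hb
          rw [add_zero, add_comm, Multiset.singleton_add]
          exact RStep.collect p q r hp h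
        | fire i j hi _ h => exact absurd hb.symm (G.ofCode_ne_act (hG.post_lt hi h) q)
        | src j hj => exact absurd hb.symm (G.ofCode_ne_act hj q)
        | wait => cases hb

theorem Holds.lt_of_wait {G : NumNet} {Q : Proc} {m : Multiset Tok} (h : Holds G Q m) {i : ℕ}
    (hi : Tok.wait i ∈ m) : i < G.n := by
  induction h with
  | nil => simp at hi
  | par _ _ ih1 ih2 => exact (Multiset.mem_add.1 hi).elim ih1 ih2
  | body => simp at hi
  | wait j hj =>
    simp only [Multiset.mem_singleton, Tok.wait.injEq] at hi
    exact hi ▸ hj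
  | src => simp at hi
  | name _ _ _ _ ih => exact ih hi

/-- The process is a restricted parallel composition of the given components. -/
def Rep (G : NumNet) (Q : Proc) (m : Multiset Tok) : Prop :=
  ∃ Q₀, Q = Proc.resList G.channels Q₀ ∧ Holds G Q₀ m

theorem Valid.rep_step {G : NumNet} (hG : G.Valid) {Q Q' : Proc} {m : Multiset Tok} {μ : Act}
    (h : G.Rep Q m) (hs : Step G.encode.defs Q μ Q') : ∃ m', G.Rep Q' m' ∧ RStep G m μ m' := by
  obtain ⟨Q₀, rfl, hQ⟩ := h
  obtain ⟨Q₁, rfl, h1, h2⟩ := step_resList.1 hs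
  obtain ⟨m', h3, h4⟩ := hG.mstep_of_step hQ h1
  exact ⟨m', ⟨Q₁, rfl, h3⟩, (hG.rstep_iff fun _ => hQ.lt_of_wait).2 ⟨h4, h2⟩⟩

theorem Valid.step_of_rep {G : NumNet} (hG : G.Valid) {Q : Proc} {m m' : Multiset Tok} {μ : Act}
    (h : G.Rep Q m) (hs : RStep G m μ m') :
    ∃ Q', G.Rep Q' m' ∧ Step G.encode.defs Q μ Q' := by
  obtain ⟨Q₀, rfl, hQ⟩ := h
  obtain ⟨h1, h2⟩ := (hG.rstep_iff fun _ => hQ.lt_of_wait).1 hs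
  obtain ⟨Q', h3, h4⟩ := hG.step_of_mstep hQ h1
  exact ⟨_, ⟨Q', rfl, h4⟩, step_resList.2 ⟨Q', rfl, h3, h2⟩⟩

/-! ## Multisets of tokens as markings -/

open Classical in
/-- The number of tokens in a place for which a component stands. -/
noncomputable def val (G : NumNet) : Tok → ℕ → ℕ
  | body i, p => if p = i ∨ (p < i ∧ G.Share p i) then 1 else 0
  | wait i, p => if p = i then 1 else 0
  | src _, _ => 0

/-- The marking for which a multiset of components stands. -/
noncomputable def mval (G : NumNet) (m : Multiset Tok) (p : ℕ) : ℕ := (m.map (G.val · p)).sum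

@[simp] theorem mval_zero (G : NumNet) (p : ℕ) : G.mval 0 p = 0 := rfl

@[simp] theorem mval_cons (G : NumNet) (x : Tok) (m : Multiset Tok) (p : ℕ) :
    G.mval (x ::ₘ m) p = G.val x p + G.mval m p := by
  simp [mval]

@[simp] theorem mval_add (G : NumNet) (m m' : Multiset Tok) (p : ℕ) :
    G.mval (m + m') p = G.mval m p + G.mval m' p := by
  simp [mval]

theorem mval_sum (G : NumNet) (k : ℕ) (f : ℕ → Multiset Tok) (p : ℕ) :
    G.mval (∑ i ∈ Finset.range k, f i) p = ∑ i ∈ Finset.range k, G.mval (f i) p := by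
  induction k with
  | zero => simp
  | succ k ih => simp [Finset.sum_range_succ, ih]

theorem exists_mem_of_mval_pos {G : NumNet} {m : Multiset Tok} {p : ℕ} (h : 1 ≤ G.mval m p) :
    ∃ x ∈ m, 1 ≤ G.val x p := by
  induction m using Multiset.induction_on with
  | empty => simp at h
  | cons x m ih =>
    rw [mval_cons] at h
    by_cases hx : 1 ≤ G.val x p
    · exact ⟨x, Multiset.mem_cons_self _ _, hx⟩
    · obtain ⟨y, hy, hy'⟩ := ih (by omega)
      exact ⟨y, Multiset.mem_cons_of_mem hy, hy'⟩

/-- As `p` immediately precedes `q` in the group, the members up to `q` are those up to `p` together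
with `q` itself. -/
theorem Valid.val_collect {G : NumNet} (hG : G.Valid) {p q : ℕ} (h : G.next p = q + 1) (x : ℕ) :
    G.val (body p) x + G.val (wait q) x = G.val (body q) x := by
  obtain ⟨hq, h⟩ := hG.next_eq_succ_iff.1 h
  obtain ⟨h1, h2, h3⟩ := hG.of_prev_eq_succ hq h
  simp only [val]
  by_cases hx : x = q
  · subst hx
    rw [if_neg (by omega), if_pos rfl, if_pos (Or.inl rfl)]
  · have : (x = p ∨ x < p ∧ G.Share x p) ↔ (x = q ∨ x < q ∧ G.Share x q) := by
      constructor
      · rintro (rfl | ⟨h4, h5⟩)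
        · exact Or.inr ⟨h1, h2⟩
        · exact Or.inr ⟨by omega, hG.share_trans (by omega) hq h5 h2⟩
      · rintro (h4 | ⟨h4, h5⟩)
        · exact absurd h4 hx
        · rcases lt_trichotomy x p with h6 | h6 | h6
          · exact Or.inr ⟨h6, hG.share_trans hq (by omega) h5 h2.symm⟩
          · exact Or.inl h6
          · exact absurd h5 (h3 x h6 h4)
    rw [if_neg hx, add_zero]
    by_cases h4 : x = p ∨ x < p ∧ G.Share x p
    · rw [if_pos h4, if_pos (this.1 h4)]
    · rw [if_neg h4, if_neg (mt this.2 h4)]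

/-- Descending from `p` along predecessors cannot jump over `i`, so it arrives at a place whose
predecessor is `i`. -/
theorem Valid.exists_next {G : NumNet} (hG : G.Valid) {i p : ℕ} (hp : p < G.n) (hip : i < p)
    (h : G.Share i p) : G.next i ≠ 0 := by
  induction p using Nat.strong_induction_on with
  | _ p ih =>
    rcases Nat.eq_zero_or_eq_succ_pred (G.prev p) with h0 | h0
    · exact absurd h (hG.not_share_of_prev_eq_zero hp h0 hip)
    · obtain ⟨h1, h2, h3⟩ := hG.of_prev_eq_succ hp h0
      rcases lt_trichotomy i (G.prev p).pred with h4 | h4 | h4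
      · exact ih _ h1 (by omega) h4 (hG.share_trans hp (by omega) h h2.symm)
      · have : G.next i = p + 1 := hG.next_eq_succ_iff.2 ⟨hp, h4 ▸ h0⟩
        omega
      · exact absurd h (h3 i h4 hip)

/-- The collector of the last place of a group holds one token from each place of the group, which
is precisely what any transition of the group consumes. -/
theorem Valid.val_complete {G : NumNet} (hG : G.Valid) {i j : ℕ} (hi : i < G.n)
    (h : G.next i = 0) (hj : G.Post i j) {p : ℕ} (hp : p < G.n) :
    G.val (body i) p = if G.Post p j then 1 else 0 := by
  have : (p = i ∨ p < i ∧ G.Share p i) ↔ G.Post p j := by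
    constructor
    · rintro (rfl | ⟨_, h1⟩)
      · exact hj
      · exact hG.share_post hi hp h1.symm hj
    · intro h1
      rcases lt_trichotomy p i with h2 | h2 | h2
      · exact Or.inr ⟨h2, j, h1, hj⟩
      · exact Or.inl h2
      · exact absurd h (hG.exists_next hp h2 ⟨j, hj, h1⟩)
  simp only [val, this]

/-- A fresh collector stands for a single token because nothing precedes the first place of a group.
-/
theorem Valid.val_tok {G : NumNet} (hG : G.Valid) {q : ℕ} (hq : q < G.n) (p : ℕ) :
    G.val (G.tok q) p = if p = q then 1 else 0 := by
  unfold tok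
  split
  · rename_i h
    have : ¬ (p < q ∧ G.Share p q) := fun h' => hG.not_share_of_prev_eq_zero hq h h'.1 h'.2
    simp only [val, this, or_false]
  · rfl

theorem mval_srcs (G : NumNet) (j p : ℕ) : G.mval (G.srcs j) p = 0 := by
  unfold srcs
  split <;> simp [mval, val]

open Classical in
theorem Valid.mval_yield {G : NumNet} (hG : G.Valid) {j : ℕ} (hj : j < G.m) (p : ℕ) :
    G.mval (G.yield j) p = if ∃ k < G.e j, G.u j k = p then 1 else 0 := by
  rw [yield, mval_add, mval_srcs, zero_add]
  have key : ∀ l ≤ G.e j, G.mval ((Multiset.range l).map fun k => G.tok (G.u j k)) p =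
      if ∃ k < l, G.u j k = p then 1 else 0 := by
    intro l hl
    induction l with
    | zero => simp
    | succ l ih =>
      rw [Multiset.range_succ, Multiset.map_cons, mval_cons, ih (by omega),
        hG.val_tok (hG.u_lt j hj l (by omega))]
      by_cases h : p = G.u j l
      -- Targets are distinct by `u_inj`, so the new edge is the only one to this place and the
      -- count stays at one.
      · rw [if_pos h, if_neg, if_pos ⟨l, by omega, h.symm⟩]
        rintro ⟨k, hk, hk'⟩
        have := hG.u_inj j hj k (by omega) l (by omega) (hk'.trans h)
        omega
      · rw [if_neg h, zero_add]
        congr 1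
        refine propext ⟨fun ⟨k, hk, hk'⟩ => ⟨k, by omega, hk'⟩, fun ⟨k, hk, hk'⟩ => ?_⟩
        rcases Nat.lt_succ_iff_lt_or_eq.1 hk with hk | rfl
        · exact ⟨k, hk, hk'⟩
        · exact absurd hk'.symm h
  exact key _ le_rfl

open Classical in
/-- The firing rule on numbered markings. -/
def Fires (G : NumNet) (V : ℕ → ℕ) (j : ℕ) (V' : ℕ → ℕ) : Prop :=
  (∀ p < G.n, G.Post p j → 1 ≤ V p) ∧
    ∀ p < G.n, V' p = (V p - if G.Post p j then 1 else 0) + if ∃ k < G.e j, G.u j k = p then 1 else 0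

/-- The invariant of reachable multisets of components. -/
structure Good (G : NumNet) (m : Multiset Tok) : Prop where
  body_lt : ∀ i, body i ∈ m → i < G.n
  prev_ne : ∀ i, wait i ∈ m → G.prev i ≠ 0
  last_eq : ∀ j, src j ∈ m → G.last j = 0
  src_mem : ∀ j < G.m, G.last j = 0 → src j ∈ m

-- The invariant, and soundness of component steps

theorem tok_mem_cases (G : NumNet) {x : Tok} {i : ℕ} (h : x = G.tok i) :
    (x = body i ∧ G.prev i = 0) ∨ (x = wait i ∧ G.prev i ≠ 0) := by
  unfold tok at h
  split at h <;> simp [*]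

theorem mem_srcs {G : NumNet} {x : Tok} {j : ℕ} : x ∈ G.srcs j ↔ x = src j ∧ G.last j = 0 := by
  unfold srcs
  split <;> simp [*]

theorem mem_yield {G : NumNet} {x : Tok} {j : ℕ} :
    x ∈ G.yield j ↔ (x = src j ∧ G.last j = 0) ∨ ∃ k < G.e j, x = G.tok (G.u j k) := by
  simp [yield, mem_srcs, eq_comm]

theorem mem_start {G : NumNet} {x : Tok} :
    x ∈ G.start ↔ (∃ i < G.n, G.w i ≠ 0 ∧ x = G.tok i) ∨ ∃ j < G.m, x = src j ∧ G.last j = 0 := by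
  simp [start, mem_srcs, Multiset.mem_sum, Multiset.mem_replicate]

theorem good_start (G : NumNet) : G.Good G.start where
  body_lt i h := by
    rcases mem_start.1 h with ⟨i', hi, _, h⟩ | ⟨j, _, h, _⟩
    · rcases G.tok_mem_cases h with ⟨h, _⟩ | ⟨h, _⟩ <;> cases h
      exact hi
    · cases h
  prev_ne i h := by
    rcases mem_start.1 h with ⟨i', hi, _, h⟩ | ⟨j, _, h, _⟩
    · rcases G.tok_mem_cases h with ⟨h, _⟩ | ⟨h, h'⟩ <;> cases h
      exact h'
    · cases h
  last_eq j h := by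
    rcases mem_start.1 h with ⟨i', hi, _, h⟩ | ⟨j, _, h, h'⟩
    · rcases G.tok_mem_cases h with ⟨h, _⟩ | ⟨h, _⟩ <;> cases h
    · cases h
      exact h'
  src_mem j hj h := mem_start.2 (Or.inr ⟨j, hj, rfl, h⟩)

theorem Valid.mval_start {G : NumNet} (hG : G.Valid) {p : ℕ} (hp : p < G.n) :
    G.mval G.start p = G.w p := by
  have h : ∀ i ∈ Finset.range G.n, G.mval (Multiset.replicate (G.w i) (G.tok i)) p =
      if p = i then G.w i else 0 := by
    intro i hi
    simp [mval, hG.val_tok (Finset.mem_range.1 hi) p]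
  rw [start, mval_add, mval_sum, mval_sum, Finset.sum_congr rfl h]
  simp [mval_srcs, hp]

/-- The only delicate point is `src_mem`: if the consumed component is a source, hypothesis `hx`
says that it is the source of `j`, which `yield` puts back. -/
theorem Good.fire {G : NumNet} (hG : G.Valid) {x : Tok} {r : Multiset Tok} {j : ℕ}
    (hm : G.Good (x ::ₘ r)) (hj : j < G.m) (hx : ∀ j', x = src j' → j' = j) :
    G.Good (r + G.yield j) where
  body_lt i h := by
    rcases Multiset.mem_add.1 h with h | h
    · exact hm.body_lt i (Multiset.mem_cons_of_mem h)
    · rcases mem_yield.1 h with ⟨h, _⟩ | ⟨k, hk, h⟩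
      · cases h
      · rcases G.tok_mem_cases h with ⟨h, _⟩ | ⟨h, _⟩ <;> cases h
        exact hG.u_lt j hj k hk
  prev_ne i h := by
    rcases Multiset.mem_add.1 h with h | h
    · exact hm.prev_ne i (Multiset.mem_cons_of_mem h)
    · rcases mem_yield.1 h with ⟨h, _⟩ | ⟨k, hk, h⟩
      · cases h
      · rcases G.tok_mem_cases h with ⟨h, _⟩ | ⟨h, h'⟩ <;> cases h
        exact h'
  last_eq i h := by
    rcases Multiset.mem_add.1 h with h | h
    · exact hm.last_eq i (Multiset.mem_cons_of_mem h)
    · rcases mem_yield.1 h with ⟨h, h'⟩ | ⟨k, hk, h⟩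
      · cases h
        exact h'
      · rcases G.tok_mem_cases h with ⟨h, _⟩ | ⟨h, h'⟩ <;> cases h
  src_mem i hi h := by
    rcases Multiset.mem_cons.1 (hm.src_mem i hi h) with h' | h'
    · obtain rfl := hx i h'.symm
      exact Multiset.mem_add.2 (Or.inr (mem_yield.2 (Or.inl ⟨rfl, h⟩)))
    · exact Multiset.mem_add.2 (Or.inl h')

theorem Good.collect {G : NumNet} {p q : ℕ} {r : Multiset Tok}
    (hm : G.Good (body p ::ₘ wait q ::ₘ r)) (hq : q < G.n) : G.Good (body q ::ₘ r) where
  body_lt i h := by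
    rcases Multiset.mem_cons.1 h with h | h
    · cases h
      exact hq
    · exact hm.body_lt i (by simp [h])
  prev_ne i h := hm.prev_ne i (by simpa using Or.inr (by simpa using h))
  last_eq j h := hm.last_eq j (by simpa using h)
  src_mem j hj h := by simpa using hm.src_mem j hj h

theorem Valid.good_rstep {G : NumNet} (hG : G.Valid) {m m' : Multiset Tok} {μ : Act}
    (hm : G.Good m) (h : RStep G m μ m') : G.Good m' := by
  cases h with
  | collect p q r hp h => exact hm.collect (hG.next_eq_succ_iff.1 h).1
  | fire i j r hi h h' => exact hm.fire hG (hG.post_lt hi h') (by simp)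
  | src j r hj => exact hm.fire hG hj (by simp [eq_comm])

/-- A collection is invisible on markings, and its decrease in cardinality rules out infinitely many
in a row. The other steps are firings in the net. -/
theorem Valid.rstep_sound {G : NumNet} (hG : G.Valid) {m m' : Multiset Tok} {μ : Act}
    (hm : G.Good m) (h : RStep G m μ m') :
    (μ = Act.tau ∧ (∀ p, G.mval m' p = G.mval m p) ∧ m'.card < m.card) ∨
      ∃ j < G.m, μ = Act.ofCode (G.c j) ∧ G.Fires (G.mval m) j (G.mval m') := by
  cases h with
  | collect p q r hp h =>
    refine Or.inl ⟨rfl, fun x => ?_, by simp⟩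
    simp only [mval_cons, ← hG.val_collect h x]
    omega
  | fire i j r hi h h' =>
    refine Or.inr ⟨j, hG.post_lt hi h', rfl, fun p hp hpj => ?_, fun p hp => ?_⟩
    · rw [mval_cons, hG.val_complete hi h h' hp, if_pos hpj]
      omega
    · rw [mval_add, hG.mval_yield (hG.post_lt hi h'), mval_cons, hG.val_complete hi h h' hp]
      congr 1
      omega
  | src j r hj =>
    have h0 := (G.last_eq_zero_iff j).1 (hm.last_eq j (Multiset.mem_cons_self _ _))
    refine Or.inr ⟨j, hj, rfl, fun p hp hpj => absurd hpj (h0 p hp), fun p hp => ?_⟩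
    rw [mval_add, hG.mval_yield hj, mval_cons, if_neg (h0 p hp)]
    simp [val]

/-- Internal steps that collect tokens. -/
def Collects (G : NumNet) : Multiset Tok → Multiset Tok → Prop :=
  Relation.ReflTransGen fun m m' => G.RStep m Act.tau m' ∧ G.Good m' ∧
    ∀ p, G.mval m' p = G.mval m p

-- Completeness: collecting the tokens for an enabled transition

theorem Collects.mval_eq {G : NumNet} {m m' : Multiset Tok} (h : G.Collects m m') (p : ℕ) :
    G.mval m' p = G.mval m p := by
  induction h with
  | refl => rfl
  | tail _ h ih => rw [h.2.2, ih]

theorem Collects.good {G : NumNet} {m m' : Multiset Tok} (h : G.Collects m m') (hm : G.Good m) :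
    G.Good m' := by
  induction h with
  | refl => exact hm
  | tail _ h _ => exact h.2.1

/-- Induction along the group of `j`. A token in `p` is either held by a collector at or beyond `p`,
and nothing remains to be done, or it waits; in the latter case the induction hypothesis supplies a
collector at or beyond the predecessor of `p`, which can collect it if it has not yet passed `p`. -/
theorem Valid.collect_upto {G : NumNet} (hG : G.Valid) {m : Multiset Tok} (hm : G.Good m) {j : ℕ}
    (hj : ∀ p < G.n, G.Post p j → 1 ≤ G.mval m p) {p : ℕ} (hp : p < G.n) (hpj : G.Post p j) :
    ∃ m', G.Collects m m' ∧ ∃ p', p ≤ p' ∧ G.Post p' j ∧ body p' ∈ m' := by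
  induction p using Nat.strong_induction_on with
  | _ p ih =>
    have hbody : ∀ m' : Multiset Tok, G.Good m' → ∀ i, body i ∈ m' → 1 ≤ G.val (body i) p →
        p ≤ i ∧ G.Post i j := by
      intro m' hm' i hi h
      simp only [val] at h
      split at h
      · rename_i h'
        rcases h' with rfl | ⟨h1, h2⟩
        · exact ⟨le_rfl, hpj⟩
        · exact ⟨h1.le, hG.share_post hp (hm'.body_lt i hi) h2 hpj⟩
      · omega
    have hwait : ∀ i, 1 ≤ G.val (wait i) p → i = p := by
      intro i h
      simp only [val] at h
      split at h
      · rename_i h'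
        exact h'.symm
      · omega
    rcases Nat.eq_zero_or_eq_succ_pred (G.prev p) with h0 | h0
    · obtain ⟨x, hx, hx'⟩ := exists_mem_of_mval_pos (hj p hp hpj)
      cases x with
      | body i =>
        obtain ⟨h1, h2⟩ := hbody m hm i hx hx'
        exact ⟨m, Relation.ReflTransGen.refl, i, h1, h2, hx⟩
      | wait i =>
        -- A place without predecessor never has waiting tokens, by the invariant.
        obtain rfl := hwait i hx'
        exact absurd h0 (hm.prev_ne i hx)
      | src j => simp [val] at hx'
    · set p₀ := (G.prev p).pred
      obtain ⟨h1, h2, h3⟩ := hG.of_prev_eq_succ hp h0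
      obtain ⟨m', hc, p', hp', hpj', hb⟩ :=
        ih p₀ h1 (by omega) (hG.share_post hp (by omega) h2.symm hpj)
      have hm' := hc.good hm
      rcases le_or_gt p p' with h4 | h4
      · exact ⟨m', hc, p', h4, hpj', hb⟩
      -- No member of the group lies strictly between `p₀` and `p`.
      obtain rfl : p' = p₀ := by
        by_contra h5
        exact h3 p' (by omega) h4 ⟨j, hpj', hpj⟩
      -- Earlier collections may have altered the components, but the marking is the same, so a
      -- token for `p` is still present after them.
      have h5 := hj p hp hpj
      rw [← hc.mval_eq] at h5
      obtain ⟨x, hx, hx'⟩ := exists_mem_of_mval_pos h5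
      cases x with
      | body i =>
        obtain ⟨h6, h7⟩ := hbody m' hm' i hx hx'
        exact ⟨m', hc, i, h6, h7, hx⟩
      | wait i =>
        obtain rfl := hwait i hx'
        obtain ⟨s, rfl⟩ := Multiset.exists_cons_of_mem hb
        obtain ⟨r, rfl⟩ := Multiset.exists_cons_of_mem
          ((Multiset.mem_cons.1 hx).resolve_left (by simp))
        have hn : G.next p₀ = i + 1 := hG.next_eq_succ_iff.2 ⟨hp, h0⟩
        have hs := RStep.collect (G := G) p₀ i r (by omega) hn
        refine ⟨body i ::ₘ r, hc.tail ⟨hs, hG.good_rstep hm' hs, fun x => ?_⟩, i, le_rfl, hpj,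
          Multiset.mem_cons_self _ _⟩
        simp only [mval_cons, ← hG.val_collect hn x]
        omega
      | src j => simp [val] at hx'

theorem Valid.rstep_complete {G : NumNet} (hG : G.Valid) {m : Multiset Tok} (hm : G.Good m)
    {j : ℕ} (hj : j < G.m) {V : ℕ → ℕ} (h : G.Fires (G.mval m) j V) :
    ∃ m₁ m₂, G.Collects m m₁ ∧ RStep G m₁ (Act.ofCode (G.c j)) m₂ ∧ G.Good m₂ ∧
      ∀ p < G.n, G.mval m₂ p = V p := by
  obtain ⟨h1, h2⟩ := h
  -- Either `j` has no incoming edges and its source component fires at once, or `p` is the last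
  -- place of its group and tokens are collected up to `p`.
  rcases G.lastAt_spec G.n j with ⟨h0, h3⟩ | ⟨p, hp, h0, h3, h4⟩
  · obtain ⟨r, rfl⟩ := Multiset.exists_cons_of_mem (hm.src_mem j hj h0)
    have hs := RStep.src (G := G) j r hj
    refine ⟨_, _, Relation.ReflTransGen.refl, hs, hG.good_rstep hm hs, fun p hp => ?_⟩
    rw [h2 p hp, mval_add, hG.mval_yield hj, mval_cons, if_neg (h3 p hp)]
    simp [val]
  · obtain ⟨m', hc, p', hp', hpj, hb⟩ := hG.collect_upto hm h1 hp h3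
    have hm' := hc.good hm
    have hlt := hm'.body_lt p' hb
    obtain rfl : p' = p := by
      by_contra h
      exact h4 p' (by omega) hlt hpj
    -- A successor of `p'` would also have an edge to `j`, contradicting the choice of the last such
    -- place.
    have hn : G.next p' = 0 := by
      by_contra h
      obtain ⟨hq, hq'⟩ := hG.next_eq_succ_iff.1 (Nat.succ_pred_eq_of_ne_zero h).symm
      obtain ⟨h5, h6, -⟩ := hG.of_prev_eq_succ hq hq'
      exact h4 _ h5 hq (hG.share_post hlt hq h6 hpj)
    obtain ⟨r, rfl⟩ := Multiset.exists_cons_of_mem hb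
    have hs := RStep.fire (G := G) p' j r hlt hn hpj
    refine ⟨_, _, hc, hs, hG.good_rstep hm' hs, fun p hp => ?_⟩
    rw [h2 p hp, ← hc.mval_eq, mval_add, hG.mval_yield hj, mval_cons,
      hG.val_complete hlt hn hpj hp]
    congr 1
    omega

end NumNet

/-! ## Weak bisimilarity and divergence from an expansion -/

namespace LTS

/-- Accessibility turns divergence into a failure of well-founded induction, so that its absence can
be transferred by induction. -/
theorem hasDivergentPath_iff (L : LTS) : L.HasDivergentPath ↔
    ∃ q, L.Reachable q ∧ ¬ Acc (fun q' q => L.tr q Act.tau q') q := by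
  constructor
  · rintro ⟨f, h, hf⟩
    exact ⟨f 0, h, not_acc_iff_exists_descending_chain.2 ⟨f, rfl, hf⟩⟩
  · rintro ⟨q, h, hq⟩
    obtain ⟨f, rfl, hf⟩ := not_acc_iff_exists_descending_chain.1 hq
    exact ⟨f, h, hf⟩

/-- A relation, with a natural number that bounds the number of additional internal steps of the
second system, such that both systems simulate each other up to these steps. -/
structure IsExpansion (L₁ L₂ : LTS) (R : L₁.State → L₂.State → ℕ → Prop) : Prop where
  left : ∀ {M Q k μ M'}, R M Q k → L₁.tr M μ M' →
    ∃ Q₁ Q' k', L₂.TauStar Q Q₁ ∧ L₂.tr Q₁ μ Q' ∧ R M' Q' k'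
  right : ∀ {M Q k μ Q'}, R M Q k → L₂.tr Q μ Q' →
    (μ = Act.tau ∧ ∃ k' < k, R M Q' k') ∨ ∃ M' k', L₁.tr M μ M' ∧ R M' Q' k'

variable {L₁ L₂ : LTS} {R : L₁.State → L₂.State → ℕ → Prop}

theorem Reachable.tauStar {L : LTS} {q q' : L.State} (h : L.Reachable q) (h' : L.TauStar q q') :
    L.Reachable q' := by
  induction h' with
  | refl => exact h
  | tail _ h ih => exact ih.tail ⟨_, h⟩

theorem IsExpansion.weaklyBisimilar (h : IsExpansion L₁ L₂ R) {k : ℕ}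
    (h0 : R L₁.init L₂.init k) : WeaklyBisimilar L₁ L₂ := by
  refine ⟨fun M Q => ∃ k, R M Q k, ⟨?_, ?_, ?_, ?_⟩, k, h0⟩
  · rintro M Q μ M' ⟨k, hR⟩ - ht
    obtain ⟨Q₁, Q', k', h1, h2, h3⟩ := h.left hR ht
    exact ⟨Q', ⟨Q₁, Q', h1, h2, Relation.ReflTransGen.refl⟩, k', h3⟩
  · rintro M Q M' ⟨k, hR⟩ ht
    obtain ⟨Q₁, Q', k', h1, h2, h3⟩ := h.left hR ht
    exact ⟨Q', h1.tail h2, k', h3⟩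
  · rintro M Q μ Q' ⟨k, hR⟩ hμ ht
    rcases h.right hR ht with ⟨h1, _⟩ | ⟨M', k', h1, h2⟩
    · exact absurd h1 hμ
    · exact ⟨M', ⟨M, M', Relation.ReflTransGen.refl, h1, Relation.ReflTransGen.refl⟩, k', h2⟩
  · rintro M Q Q' ⟨k, hR⟩ ht
    rcases h.right hR ht with ⟨_, k', _, h1⟩ | ⟨M', k', h1, h2⟩
    · exact ⟨M, Relation.ReflTransGen.refl, k', h1⟩
    · exact ⟨M', Relation.ReflTransGen.single h1, k', h2⟩

/-- Lexicographic induction: an internal step of the second system either is matched by an internal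
step of the first, or lowers `k` while `M` stays fixed. -/
theorem IsExpansion.acc_right (h : IsExpansion L₁ L₂ R) {M : L₁.State}
    (hM : Acc (fun q' q => L₁.tr q Act.tau q') M) {Q : L₂.State} {k : ℕ} (hR : R M Q k) :
    Acc (fun q' q => L₂.tr q Act.tau q') Q := by
  induction hM generalizing Q k with
  | intro M _ ih =>
    induction k using Nat.strong_induction_on generalizing Q with
    | _ k ihk =>
      refine Acc.intro _ fun Q' ht => ?_
      rcases h.right hR ht with ⟨_, k', hk, h1⟩ | ⟨M', k', h1, h2⟩
      · exact ihk k' hk h1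
      · exact ih M' h1 h2

/-- Each internal step of the first system is answered by at least one internal step of the second,
so induction on the transitive closure applies. -/
theorem IsExpansion.acc_left (h : IsExpansion L₁ L₂ R) {Q : L₂.State}
    (hQ : Acc (fun q' q => L₂.tr q Act.tau q') Q) {M : L₁.State} {k : ℕ} (hR : R M Q k) :
    Acc (fun q' q => L₁.tr q Act.tau q') M := by
  replace hQ := hQ.transGen
  induction hQ generalizing M k with
  | intro Q _ ih =>
    refine Acc.intro _ fun M' ht => ?_
    obtain ⟨Q₁, Q', k', h1, h2, h3⟩ := h.left hR ht
    refine ih Q' ?_ h3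
    have : Relation.TransGen (fun q q' => L₂.tr q Act.tau q') Q Q' := Relation.TransGen.tail' h1 h2
    exact Relation.transGen_swap.1 this

theorem IsExpansion.reachable_left (h : IsExpansion L₁ L₂ R) {k : ℕ} (h0 : R L₁.init L₂.init k)
    {M : L₁.State} (hM : L₁.Reachable M) : ∃ Q k, L₂.Reachable Q ∧ R M Q k := by
  induction hM with
  | refl => exact ⟨_, k, Relation.ReflTransGen.refl, h0⟩
  | tail _ ht ih =>
    obtain ⟨μ, ht⟩ := ht
    obtain ⟨Q, k, hQ, hR⟩ := ih
    obtain ⟨Q₁, Q', k', h1, h2, h3⟩ := h.left hR ht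
    exact ⟨Q', k', (hQ.tauStar h1).tail ⟨_, h2⟩, h3⟩

theorem IsExpansion.reachable_right (h : IsExpansion L₁ L₂ R) {k : ℕ} (h0 : R L₁.init L₂.init k)
    {Q : L₂.State} (hQ : L₂.Reachable Q) : ∃ M k, L₁.Reachable M ∧ R M Q k := by
  induction hQ with
  | refl => exact ⟨_, k, Relation.ReflTransGen.refl, h0⟩
  | tail _ ht ih =>
    obtain ⟨μ, ht⟩ := ht
    obtain ⟨M, k, hM, hR⟩ := ih
    rcases h.right hR ht with ⟨_, k', _, h1⟩ | ⟨M', k', h1, h2⟩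
    · exact ⟨M, k', hM, h1⟩
    · exact ⟨M', k', hM.tail ⟨_, h1⟩, h2⟩

theorem IsExpansion.hasDivergentPath_iff (h : IsExpansion L₁ L₂ R) {k : ℕ}
    (h0 : R L₁.init L₂.init k) : L₁.HasDivergentPath ↔ L₂.HasDivergentPath := by
  rw [LTS.hasDivergentPath_iff, LTS.hasDivergentPath_iff]
  constructor
  · rintro ⟨M, hM, hM'⟩
    obtain ⟨Q, k, hQ, hR⟩ := h.reachable_left h0 hM
    exact ⟨Q, hQ, fun hA => hM' (h.acc_left hA hR)⟩
  · rintro ⟨Q, hQ, hQ'⟩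
    obtain ⟨M, k, hM, hR⟩ := h.reachable_right h0 hQ
    exact ⟨M, hM, fun hA => hQ' (h.acc_right hA hR)⟩

end LTS

/-! ## Numbering a net -/

namespace PetriNet.AdjacencyList

variable {P T : Type*} [Fintype P] [Fintype T] {N : PetriNet P T}

/-- The numbers of the targets of the edges from a place. -/
def placeTargets (L : N.AdjacencyList) (i : ℕ) : List ℕ :=
  if h : i < Fintype.card P then
    (L.placeOut (L.placeNo.symm ⟨i, h⟩)).map fun t => (L.transNo t : ℕ)
  else []

/-- The numbers of the targets of the edges from a transition. -/
def transTargets (L : N.AdjacencyList) (j : ℕ) : List ℕ :=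
  if h : j < Fintype.card T then
    (L.transOut (L.transNo.symm ⟨j, h⟩)).map fun p => (L.placeNo p : ℕ)
  else []

/-- The numbered net for an adjacency-list representation and a marking. -/
def toNumNet (L : N.AdjacencyList) (M₀ : P → ℕ) : NumNet where
  n := Fintype.card P
  m := Fintype.card T
  w i := if h : i < Fintype.card P then M₀ (L.placeNo.symm ⟨i, h⟩) else 0
  d i := (L.placeTargets i).length
  o i k := (L.placeTargets i).getD k 0
  c j := if h : j < Fintype.card T then
    (N.label (L.transNo.symm ⟨j, h⟩)).elim 0 (fun a => a + 1) else 0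
  e j := (L.transTargets j).length
  u j k := (L.transTargets j).getD k 0

theorem placeTargets_placeNo (L : N.AdjacencyList) (p : P) :
    L.placeTargets (L.placeNo p) = (L.placeOut p).map fun t => (L.transNo t : ℕ) := by
  simp [placeTargets]

theorem transTargets_transNo (L : N.AdjacencyList) (t : T) :
    L.transTargets (L.transNo t) = (L.transOut t).map fun p => (L.placeNo p : ℕ) := by
  simp [transTargets]

theorem exists_placeNo (L : N.AdjacencyList) {i : ℕ} (hi : i < Fintype.card P) :
    ∃ p, (L.placeNo p : ℕ) = i := ⟨L.placeNo.symm ⟨i, hi⟩, by simp⟩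

theorem exists_transNo (L : N.AdjacencyList) {j : ℕ} (hj : j < Fintype.card T) :
    ∃ t, (L.transNo t : ℕ) = j := ⟨L.transNo.symm ⟨j, hj⟩, by simp⟩

theorem _root_.List.exists_getD_eq_iff_mem {α : Type*} {l : List α} {a b : α} :
    (∃ k, k < l.length ∧ l.getD k b = a) ↔ a ∈ l := by
  rw [List.mem_iff_getElem]
  constructor
  · rintro ⟨k, hk, h⟩
    exact ⟨k, hk, by rwa [List.getD_eq_getElem _ _ hk] at h⟩
  · rintro ⟨k, hk, h⟩
    exact ⟨k, hk, by rwa [List.getD_eq_getElem _ _ hk]⟩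

theorem post_iff (L : N.AdjacencyList) (M₀ : P → ℕ) (p : P) (t : T) :
    (L.toNumNet M₀).Post (L.placeNo p) (L.transNo t) ↔ (p, t) ∈ N.inEdges := by
  have : (L.toNumNet M₀).Post (L.placeNo p) (L.transNo t) ↔
      (L.transNo t : ℕ) ∈ L.placeTargets (L.placeNo p) := List.exists_getD_eq_iff_mem
  rw [this, placeTargets_placeNo, ← L.mem_placeOut]
  simp [Fin.val_inj]

theorem exists_u_iff (L : N.AdjacencyList) (M₀ : P → ℕ) (p : P) (t : T) :
    (∃ k < (L.toNumNet M₀).e (L.transNo t), (L.toNumNet M₀).u (L.transNo t) k = L.placeNo p) ↔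
      (t, p) ∈ N.outEdges := by
  have : (∃ k < (L.toNumNet M₀).e (L.transNo t),
      (L.toNumNet M₀).u (L.transNo t) k = L.placeNo p) ↔
      (L.placeNo p : ℕ) ∈ L.transTargets (L.transNo t) := List.exists_getD_eq_iff_mem
  rw [this, transTargets_transNo, ← L.mem_transOut]
  simp [Fin.val_inj]

theorem ofCode_c (L : N.AdjacencyList) (M₀ : P → ℕ) (t : T) :
    Act.ofCode ((L.toNumNet M₀).c (L.transNo t)) = N.action t := by
  have : (L.toNumNet M₀).c (L.transNo t) = (N.label t).elim 0 (fun a => a + 1) := by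
    simp [toNumNet]
  rw [this, action]
  cases N.label t <;> simp [Act.ofCode]

theorem toNumNet_w (L : N.AdjacencyList) (M₀ : P → ℕ) (p : P) :
    (L.toNumNet M₀).w (L.placeNo p) = M₀ p := by
  simp [toNumNet]

/-- Distinctness of targets comes from the duplicate-free adjacency lists; of the two cases of group
choice, disjointness is excluded by the common transition. -/
theorem valid_toNumNet (L : N.AdjacencyList) (M₀ : P → ℕ) (hN : N.IsGroupChoice) :
    (L.toNumNet M₀).Valid where
  o_lt i hi k hk := by
    obtain ⟨p, rfl⟩ := L.exists_placeNo hi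
    change (L.placeTargets _).getD k 0 < Fintype.card T
    have := (List.exists_getD_eq_iff_mem (b := 0)).1 ⟨k, hk, rfl⟩
    rw [placeTargets_placeNo] at this ⊢
    obtain ⟨t, _, h⟩ := List.mem_map.1 this
    rw [← h]
    exact (L.transNo t).2
  u_lt j hj k hk := by
    obtain ⟨t, rfl⟩ := L.exists_transNo hj
    change (L.transTargets _).getD k 0 < Fintype.card P
    have := (List.exists_getD_eq_iff_mem (b := 0)).1 ⟨k, hk, rfl⟩
    rw [transTargets_transNo] at this ⊢
    obtain ⟨p, _, h⟩ := List.mem_map.1 this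
    rw [← h]
    exact (L.placeNo p).2
  u_inj j hj k hk k' hk' h := by
    obtain ⟨t, rfl⟩ := L.exists_transNo hj
    have hn : (L.transTargets (L.transNo t)).Nodup := by
      rw [transTargets_transNo]
      exact (L.transOut_nodup t).map fun p q h => L.placeNo.injective (Fin.val_injective h)
    change k < (L.transTargets (L.transNo t)).length at hk
    change k' < (L.transTargets (L.transNo t)).length at hk'
    change (L.transTargets (L.transNo t)).getD k 0 = (L.transTargets (L.transNo t)).getD k' 0 at h
    rw [List.getD_eq_getElem _ _ hk, List.getD_eq_getElem _ _ hk'] at h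
    exact (hn.getElem_inj_iff).1 h
  groupChoice i hi i' hi' j h h' j' hj := by
    obtain ⟨p, rfl⟩ := L.exists_placeNo hi
    obtain ⟨q, rfl⟩ := L.exists_placeNo hi'
    have trans : ∀ {p : P} {j : ℕ}, (L.toNumNet M₀).Post (L.placeNo p) j →
        ∃ t, (L.transNo t : ℕ) = j := by
      intro p j h
      have := List.exists_getD_eq_iff_mem.1 h
      rw [placeTargets_placeNo] at this
      obtain ⟨t, _, h⟩ := List.mem_map.1 this
      exact ⟨t, h⟩
    obtain ⟨t, rfl⟩ := trans h
    obtain ⟨t', rfl⟩ := trans hj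
    rw [post_iff] at *
    rcases hN p q with h1 | h1
    · change t' ∈ N.postset q
      rw [← h1]
      exact hj
    · exact absurd h' (Set.disjoint_left.1 h1 h)

-- The net and its encoding form an expansion

open Classical in
theorem fires_iff (L : N.AdjacencyList) (M₀ M M' : P → ℕ) (V V' : ℕ → ℕ) (t : T)
    (hV : ∀ p, M p = V (L.placeNo p)) (hV' : ∀ p, M' p = V' (L.placeNo p)) :
    (L.toNumNet M₀).Fires V (L.transNo t) V' ↔ N.Enabled M t ∧ M' = N.fire M t := by
  have hall : ∀ {A : ℕ → Prop}, (∀ i < (L.toNumNet M₀).n, A i) ↔ ∀ p, A (L.placeNo p) := by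
    intro A
    constructor
    · exact fun h p => h _ (L.placeNo p).2
    · intro h i hi
      obtain ⟨p, rfl⟩ := L.exists_placeNo hi
      exact h p
  rw [NumNet.Fires, hall, hall, funext_iff]
  simp only [Enabled, fire, post_iff, exists_u_iff, hV, hV']

/-- The relation between markings and processes. -/
def Related (L : N.AdjacencyList) (M₀ : P → ℕ) (M : P → ℕ) (Q : Proc) (k : ℕ) : Prop :=
  ∃ m, (L.toNumNet M₀).Rep Q m ∧ (L.toNumNet M₀).Good m ∧
    (∀ p, M p = (L.toNumNet M₀).mval m (L.placeNo p)) ∧ k = m.card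

theorem isExpansion (L : N.AdjacencyList) (M₀ : P → ℕ) (hN : N.IsGroupChoice) :
    LTS.IsExpansion (N.toLTS M₀) (L.toNumNet M₀).encode.toLTS (L.Related M₀) := by
  have hG := L.valid_toNumNet M₀ hN
  constructor
  · rintro M Q k μ M' ⟨m, hR, hm, hM, rfl⟩ ⟨t, ht, rfl, rfl⟩
    -- Extension by zero outside the place numbers; firing of numbered markings constrains only
    -- indices below `n`.
    obtain ⟨V, hV⟩ : ∃ V : ℕ → ℕ, ∀ p, N.fire M t p = V (L.placeNo p) :=
      ⟨fun i => if h : i < Fintype.card P then N.fire M t (L.placeNo.symm ⟨i, h⟩) else 0,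
        fun p => by simp⟩
    have hf := (L.fires_iff M₀ M _ _ V t hM hV).2 ⟨ht, rfl⟩
    obtain ⟨m₁, m₂, h1, h2, h3, h4⟩ := hG.rstep_complete hm (L.transNo t).2 hf
    have hc : ∃ Q₁, (L.toNumNet M₀).Rep Q₁ m₁ ∧ (L.toNumNet M₀).encode.toLTS.TauStar Q Q₁ := by
      clear h2
      induction h1 with
      | refl => exact ⟨Q, hR, Relation.ReflTransGen.refl⟩
      | tail _ hs ih =>
        obtain ⟨Q₁, h5, h6⟩ := ih
        obtain ⟨Q₂, h7, h8⟩ := hG.step_of_rep h5 hs.1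
        exact ⟨Q₂, h7, h6.tail h8⟩
    obtain ⟨Q₁, h5, h6⟩ := hc
    obtain ⟨Q₂, h7, h8⟩ := hG.step_of_rep h5 h2
    rw [ofCode_c] at h8
    exact ⟨Q₁, Q₂, _, h6, h8, m₂, h7, h3, fun p => by rw [hV, h4 _ (L.placeNo p).2], rfl⟩
  · rintro M Q k μ Q' ⟨m, hR, hm, hM, rfl⟩ hs
    obtain ⟨m', h1, h2⟩ := hG.rep_step hR hs
    have hm' := hG.good_rstep hm h2
    rcases hG.rstep_sound hm h2 with ⟨h3, h4, h5⟩ | ⟨j, hj, rfl, h3⟩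
    · exact Or.inl ⟨h3, _, h5, m', h1, hm', fun p => by rw [hM, h4], rfl⟩
    · obtain ⟨t, rfl⟩ := L.exists_transNo hj
      obtain ⟨h4, h5⟩ := (L.fires_iff M₀ M (fun p => (L.toNumNet M₀).mval m' (L.placeNo p)) _ _ t hM
        fun _ => rfl).1 h3
      exact Or.inr ⟨_, _, ⟨t, h4, (L.ofCode_c M₀ t).symm, h5⟩, m', h1, hm', fun _ => rfl, rfl⟩

theorem related_init (L : N.AdjacencyList) (M₀ : P → ℕ) (hN : N.IsGroupChoice) :
    L.Related M₀ (N.toLTS M₀).init (L.toNumNet M₀).encode.toLTS.init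
      (L.toNumNet M₀).start.card :=
  ⟨_, ⟨_, rfl, (L.toNumNet M₀).holds_initial⟩, (L.toNumNet M₀).good_start, fun p => by
    rw [(L.valid_toNumNet M₀ hN).mval_start (L.placeNo p).2, toNumNet_w]; rfl, rfl⟩

-- Size of the numbered net

theorem sum_range_card {α : Type*} [Fintype α] (e : α ≃ Fin (Fintype.card α)) (f : ℕ → ℕ) :
    ∑ i ∈ Finset.range (Fintype.card α), f i = ∑ a, f (e a) := by
  rw [Finset.sum_range, ← e.sum_comp]

/-- Edges are counted by their source; each fibre is listed once without repetition. -/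
theorem sum_length_eq_card {α β : Type*} [Fintype α] (E : Finset (α × β)) (l : α → List β)
    (hl : ∀ a, (l a).Nodup) (h : ∀ a b, b ∈ l a ↔ (a, b) ∈ E) :
    ∑ a, (l a).length = E.card := by
  classical
  rw [Finset.card_eq_sum_card_fiberwise (f := Prod.fst) (t := Finset.univ) (by simp)]
  refine Finset.sum_congr rfl fun a _ => ?_
  rw [← List.toFinset_card_of_nodup (hl a)]
  refine Finset.card_bij (fun b _ => (a, b)) ?_ ?_ ?_
  · intro b hb
    simpa [h] using hb
  · intro b _ b' _ hb
    simpa using hb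
  · rintro ⟨a', b⟩ hb
    simp only [Finset.mem_filter] at hb
    obtain ⟨hb, rfl⟩ := hb
    exact ⟨b, by simpa [h] using hb, rfl⟩

theorem total_toNumNet (L : N.AdjacencyList) (M₀ : P → ℕ) :
    (L.toNumNet M₀).total = N.size + ∑ p, M₀ p := by
  have h1 : ∑ i ∈ Finset.range (Fintype.card P), (L.toNumNet M₀).d i = N.inEdges.card := by
    rw [sum_range_card L.placeNo, ← sum_length_eq_card _ _ L.placeOut_nodup L.mem_placeOut]
    exact Finset.sum_congr rfl fun p _ => by simp [toNumNet, placeTargets_placeNo]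
  have h2 : ∑ i ∈ Finset.range (Fintype.card T), (L.toNumNet M₀).e i = N.outEdges.card := by
    rw [sum_range_card L.transNo, ← sum_length_eq_card _ _ L.transOut_nodup L.mem_transOut]
    exact Finset.sum_congr rfl fun p _ => by simp [toNumNet, transTargets_transNo]
  have h3 : ∑ i ∈ Finset.range (Fintype.card P), (L.toNumNet M₀).w i = ∑ p, M₀ p := by
    rw [sum_range_card L.placeNo]
    exact Finset.sum_congr rfl fun p _ => L.toNumNet_w M₀ p
  have hn : (L.toNumNet M₀).n = Fintype.card P := rfl
  have hm : (L.toNumNet M₀).m = Fintype.card T := rfl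
  rw [NumNet.total, PetriNet.size, hn, hm, h1, h2, h3]
  ring

end PetriNet.AdjacencyList

/-! ## Total correctness of random access machine programs -/

namespace Ram

/-- The program halts, in a configuration and after a number of steps that satisfy `Q`. -/
def WP (c : Prog) (s : Config) (Q : Config → ℕ → Prop) : Prop := ∃ s' t, Run c s s' t ∧ Q s' t

variable {s : Config} {Q : Config → ℕ → Prop}

theorem wp_skip (h : Q s 1) : WP Prog.skip s Q := ⟨_, _, Run.skip s, h⟩

theorem wp_assign {x : ℕ} {e : Expr}
    (h : Q { s with reg := Function.update s.reg x (e.eval s) } (1 + e.cost)) :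
    WP (Prog.assign x e) s Q := ⟨_, _, Run.assign x e s, h⟩

theorem wp_store {A : ℕ} {i e : Expr}
    (h : Q
      { s with arr := Function.update s.arr A (Function.update (s.arr A) (i.eval s) (e.eval s)) }
      (1 + i.cost + e.cost)) :
    WP (Prog.store A i e) s Q := ⟨_, _, Run.store A i e s, h⟩

theorem wp_output {e : Expr} (h : Q { s with out := s.out ++ [e.eval s] } (1 + e.cost)) :
    WP (Prog.output e) s Q := ⟨_, _, Run.output e s, h⟩

theorem wp_seq {c c' : Prog} (h : WP c s fun s' t => WP c' s' fun s'' t' => Q s'' (t + t')) :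
    WP (Prog.seq c c') s Q := by
  obtain ⟨s', t, h, s'', t', h', hQ⟩ := h
  exact ⟨_, _, Run.seq h h', hQ⟩

theorem wp_ite {e : Expr} {c c' : Prog}
    (h : e.eval s ≠ 0 → WP c s fun s' t => Q s' (1 + e.cost + t))
    (h' : e.eval s = 0 → WP c' s fun s' t => Q s' (1 + e.cost + t)) :
    WP (Prog.ite e c c') s Q := by
  by_cases he : e.eval s = 0
  · obtain ⟨s', t, h, hQ⟩ := h' he
    exact ⟨_, _, Run.ite_false he h, hQ⟩
  · obtain ⟨s', t, h, hQ⟩ := h he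
    exact ⟨_, _, Run.ite_true he h, hQ⟩

/-- Run the body with register `x` counting from zero up to the value of register `b`. -/
def Prog.upTo (x b : ℕ) (c : Prog) : Prog :=
  Prog.seq (Prog.assign x (Expr.const 0))
    (Prog.loop (Expr.sub (Expr.reg b) (Expr.reg x))
      (Prog.seq c (Prog.assign x (Expr.add (Expr.reg x) (Expr.const 1)))))

/-- Each round costs 4 for the test and 4 for the increment besides its body; the final 6 are the
initial assignment and the last, failing test. The body has to restore the counter register to `k`.
-/
theorem wp_upTo {x b N : ℕ} {c : Prog} (I : ℕ → Config → Prop) (cost : ℕ → ℕ)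
    (init : I 0 { s with reg := Function.update s.reg x 0 })
    (count : ∀ k s, I k s → s.reg x = k ∧ s.reg b = N)
    (step : ∀ k < N, ∀ s, I k s → WP c s fun s' t => s'.reg x = k ∧
      I (k + 1) { s' with reg := Function.update s'.reg x (k + 1) } ∧ t ≤ cost k)
    (post : ∀ s' t, I N s' → t ≤ ∑ k ∈ Finset.range N, (cost k + 8) + 6 → Q s' t) :
    WP (Prog.upTo x b c) s Q := by
  -- Induction on the number `l` of remaining rounds, with the costs of the rounds already done on
  -- the left-hand side.
  have key : ∀ l k, k + l = N → ∀ s, I k s → ∃ s' t,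
      Run (Prog.loop (Expr.sub (Expr.reg b) (Expr.reg x))
        (Prog.seq c (Prog.assign x (Expr.add (Expr.reg x) (Expr.const 1))))) s s' t ∧ I N s' ∧
      t + ∑ k ∈ Finset.range k, (cost k + 8) ≤ ∑ k ∈ Finset.range N, (cost k + 8) + 4 := by
    intro l
    induction l with
    | zero =>
      intro k hk s hs
      obtain rfl : k = N := hk
      refine ⟨s, _, Run.loop_false ?_, hs, ?_⟩
      · simp [Expr.eval, count _ _ hs]
      · simp only [Expr.cost]
        omega
    | succ l ih =>
      intro k hk s hs
      obtain ⟨s', t, hr, hx, hI, ht⟩ := step k (by omega) s hs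
      obtain ⟨s'', t', hr', hI', ht'⟩ := ih (k + 1) (by omega) _ hI
      refine ⟨s'', _, Run.loop_true (n' := t') ?_ (Run.seq hr (Run.assign _ _ _)) ?_, hI', ?_⟩
      · simp only [Expr.eval, count _ _ hs]
        omega
      · simpa only [Expr.eval, hx] using hr'
      · rw [Finset.sum_range_succ] at ht'
        simp only [Expr.cost]
        omega
  obtain ⟨s', t, h1, h2, h3⟩ := key N 0 (by omega) _ init
  refine ⟨s', _, Run.seq (Run.assign _ _ _) h1, post _ _ h2 ?_⟩
  simp only [Expr.cost, Finset.range_zero, Finset.sum_empty] at h3 ⊢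
  omega

end Ram

/-! ## The program -/

namespace Encoder

open Ram

/-- Number of places. -/
abbrev rN : Expr := .reg 0
/-- Reading position in the input. -/
abbrev rPos : Expr := .reg 2
/-- Counter of outer loops. -/
abbrev rI : Expr := .reg 3
/-- Counter of inner loops. -/
abbrev rK : Expr := .reg 4
/-- The base of the channels. -/
abbrev rBase : Expr := .reg 5
/-- The number of rounds of an inner loop. -/
abbrev rBound : Expr := .reg 6
/-- The current place or transition. -/
abbrev rCur : Expr := .reg 7

/-- Write the values of some expressions. -/
def print (l : List Expr) : Prog := l.foldr (fun e c => Prog.seq (Prog.output e) c) Prog.skip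

/-- The input at an offset from the reading position. -/
def look (e : Expr) : Expr := .get 0 (.add rPos e)

/-- Move the reading position behind a record with `e` edges. -/
def advance (e : Expr) : Prog := .assign 2 (.add (.add rPos (.const 2)) e)

/-- Read the places, and compute the arrays `last`, `nextAt` and `prev`. -/
def scanPlaces : Prog :=
  .upTo 3 0 <|
    .seq (.assign 6 (look (.const 1))) <|
    .seq (.ite rBound (.assign 7 (.get 1 (look (.const 2)))) (.assign 7 (.const 0))) <|
    .seq (.store 3 rI rCur) <|
    .seq (.store 2 rCur (.add rI (.const 1))) <|
    .seq (.upTo 4 6 (.store 1 (look (.add (.const 2) rK)) (.add rI (.const 1)))) <|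
    advance rBound

/-- Read the transitions, store their codes and compute the base of the channels. -/
def scanTransitions : Prog :=
  .upTo 3 1 <|
    .seq (.assign 6 (look (.const 0))) <|
    .seq (.store 4 rI rBound) <|
    .seq (.assign 5 (.add rBase rBound)) <|
    advance (look (.const 1))

/-- Write a token in the current place. -/
def printToken : Prog :=
  .ite (.get 3 rCur) (print [.const 3, .add rBase rCur, .const 0]) (print [.const 7, rCur])

/-- Write the emission of the current transition. -/
def printEmit : Prog :=
  .seq (.ite (.get 4 rCur) (print [.const 2, .sub (.get 4 rCur) (.const 1)]) (print [.const 1])) <|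
  print [.const 7, .add rN rCur]

/-- Write the current transition as a component if it has no incoming edges. -/
def printSources : Prog := .ite (.get 1 rCur) .skip (.seq (.output (.const 5)) printEmit)

/-- Write the restrictions. -/
def printChannels : Prog := .upTo 3 0 (print [.const 6, .add rBase rI])

/-- Write the tokens of the initial marking. -/
def printMarking : Prog :=
  .seq (.assign 2 (.const 2)) <|
  .upTo 3 0 <|
    .seq (.assign 6 (look (.const 0))) <|
    .seq (.upTo 4 6 (.seq (.output (.const 5)) (.seq (.assign 7 rI) printToken))) <|
    advance (look (.const 1))

/-- Write the transitions without incoming edges. -/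
def printAllSources : Prog := .upTo 3 1 (.seq (.assign 7 rI) printSources)

/-- Write the equations for places. -/
def printCollectors : Prog :=
  .seq (.assign 2 (.const 2)) <|
  .upTo 3 0 <|
    .seq (.output rI) <|
    .seq (.assign 6 (look (.const 1))) <|
    .seq (.assign 7 (.get 2 (.add rI (.const 1)))) <|
    .seq (.ite rCur
      (print [.const 2, .add rBase (.sub rCur (.const 1)), .const 7, .sub rCur (.const 1)]) <|
      .seq (.upTo 4 6 <|
        .seq (.output (.const 4)) <|
        .seq (.assign 7 (look (.add (.const 2) rK))) printEmit) <|
      .output (.const 0)) <|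
    advance rBound

/-- Write the equations for transitions. -/
def printProducts : Prog :=
  .upTo 3 1 <|
    .seq (.output (.add rN rI)) <|
    .seq (.assign 7 rI) <|
    .seq printSources <|
    .seq (.assign 6 (look (.const 1))) <|
    .seq (.upTo 4 6 <|
      .seq (.output (.const 5)) <|
      .seq (.assign 7 (look (.add (.const 2) rK))) printToken) <|
    .seq (.output (.const 0)) <|
    advance rBound

/-- The encoding algorithm. -/
def encoder : Prog :=
  .seq (.assign 0 (.get 0 (.const 0))) <|
  .seq (.assign 1 (.get 0 (.const 1))) <|
  .seq (.assign 2 (.const 2)) <|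
  .seq scanPlaces <|
  .seq scanTransitions <|
  .seq printChannels <|
  .seq printMarking <|
  .seq printAllSources <|
  .seq (.output (.const 0)) <|
  .seq printCollectors printProducts

/-! ### Reading the input -/

/-- The position of the record of place `i` in the input. -/
def posP (G : NumNet) (i : ℕ) : ℕ := 2 + ∑ i' ∈ Finset.range i, (2 + G.d i')

/-- The position of the record of transition `j` in the input. -/
def posT (G : NumNet) (j : ℕ) : ℕ := posP G G.n + ∑ j' ∈ Finset.range j, (2 + G.e j')

theorem posP_succ (G : NumNet) (i : ℕ) : posP G (i + 1) = posP G i + 2 + G.d i := by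
  simp [posP, Finset.sum_range_succ, add_assoc]

theorem posT_succ (G : NumNet) (j : ℕ) : posT G (j + 1) = posT G j + 2 + G.e j := by
  simp [posT, Finset.sum_range_succ, add_assoc]

/-- The array contains a numbered net. -/
structure Layout (G : NumNet) (a : ℕ → ℕ) : Prop where
  n : a 0 = G.n
  m : a 1 = G.m
  w : ∀ i < G.n, a (posP G i) = G.w i
  d : ∀ i < G.n, a (posP G i + 1) = G.d i
  o : ∀ i < G.n, ∀ k < G.d i, a (posP G i + (2 + k)) = G.o i k
  c : ∀ j < G.m, a (posT G j) = G.c j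
  e : ∀ j < G.m, a (posT G j + 1) = G.e j
  u : ∀ j < G.m, ∀ k < G.e j, a (posT G j + (2 + k)) = G.u j k

/-- The configuration while the places are read. -/
structure ScanP (G : NumNet) (a : ℕ → ℕ) (i : ℕ) (s : Config) : Prop where
  n : s.reg 0 = G.n
  m : s.reg 1 = G.m
  pos : s.reg 2 = posP G i
  ctr : s.reg 3 = i
  base : s.reg 5 = 0
  inp : s.arr 0 = a
  last : ∀ j, s.arr 1 j = G.lastAt i j
  next : ∀ x, s.arr 2 x = G.nextAt i x
  prev : ∀ p < i, s.arr 3 p = G.prev p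
  out : s.out = []

/-- The configuration while the edges from place `i` are read. -/
structure ScanE (G : NumNet) (a : ℕ → ℕ) (i k : ℕ) (s : Config) : Prop where
  n : s.reg 0 = G.n
  m : s.reg 1 = G.m
  pos : s.reg 2 = posP G i
  ctr : s.reg 3 = i
  cnt : s.reg 4 = k
  base : s.reg 5 = 0
  bound : s.reg 6 = G.d i
  inp : s.arr 0 = a
  last : ∀ j, s.arr 1 j = if ∃ k', k' < k ∧ G.o i k' = j then i + 1 else G.lastAt i j
  next : ∀ x, s.arr 2 x = G.nextAt (i + 1) x
  prev : ∀ p < i + 1, s.arr 3 p = G.prev p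
  out : s.out = []

variable {G : NumNet} {a : ℕ → ℕ} {s : Config} {Q : Config → ℕ → Prop}

/-- Writing `i + 1` at every target of `i`, one edge at a time, turns the table `lastAt i` into
`lastAt (i + 1)`. -/
theorem wp_scanEdges (hL : Layout G a) {i : ℕ} (hi : i < G.n)
    (h : ScanE G a i 0 { s with reg := Function.update s.reg 4 0 })
    (hQ : ∀ s' t, ScanE G a i (G.d i) s' → t ≤ 30 * G.d i + 6 → Q s' t) :
    WP (.upTo 4 6 (.store 1 (look (.add (.const 2) rK)) (.add rI (.const 1)))) s Q := by
  refine wp_upTo (ScanE G a i) (fun _ => 12) h (fun k s h => ⟨h.cnt, h.bound⟩) ?_ ?_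
  · intro k hk s h
    refine wp_store ⟨h.cnt, ?_, by simp [look, Expr.cost]⟩
    have hv : (look (.add (.const 2) rK)).eval s = G.o i k := by
      simp [look, Expr.eval, h.inp, h.pos, h.cnt, hL.o i hi k hk]
    have hv' : (Expr.add rI (.const 1)).eval s = i + 1 := by simp [Expr.eval, h.ctr]
    rw [hv, hv']
    refine ⟨by simp [h.n], by simp [h.m], by simp [h.pos], by simp [h.ctr], by simp,
      by simp [h.base], by simp [h.bound], by simp [h.inp], fun j => ?_, by simp [h.next],
      by simpa using h.prev, h.out⟩
    by_cases hj : j = G.o i k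
    · subst hj
      rw [if_pos ⟨k, by omega, rfl⟩]
      simp
    · have : (∃ k', k' < k + 1 ∧ G.o i k' = j) ↔ ∃ k', k' < k ∧ G.o i k' = j := by
        constructor
        · rintro ⟨k', h1, h2⟩
          rcases Nat.lt_succ_iff_lt_or_eq.1 h1 with h3 | rfl
          · exact ⟨k', h3, h2⟩
          · exact absurd h2.symm hj
        · rintro ⟨k', h1, h2⟩
          exact ⟨k', by omega, h2⟩
      rw [if_congr this rfl rfl, ← h.last]
      simp [hj]
  · intro s' t h ht
    refine hQ s' t h (ht.trans ?_)
    simp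
    omega

/-- The order of operations matters: the predecessor of `i` is looked up while array 1 still
describes the places before `i`, and the edges of `i` are entered only afterwards. -/
theorem wp_scanPlaces (hL : Layout G a)
    (h : ScanP G a 0 { s with reg := Function.update s.reg 3 0 })
    (hQ : ∀ s' t, ScanP G a G.n s' →
      t ≤ 70 * G.n + 30 * ∑ i ∈ Finset.range G.n, G.d i + 6 → Q s' t) :
    WP scanPlaces s Q := by
  refine wp_upTo (ScanP G a) (fun i => 62 + 30 * G.d i) h (fun k s h => ⟨h.ctr, h.n⟩) ?_ ?_
  · intro i hi s h
    refine wp_seq (wp_assign (wp_seq ?_))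
    have hd : (look (.const 1)).eval s = G.d i := by
      simp [look, Expr.eval, h.inp, h.pos, hL.d i hi]
    rw [hd]
    -- Both branches of the conditional leave `prev i` in register 7 and differ only in time (8 or 4
    -- steps), so the rest of the body is treated once. The summand 5 is the cost of the preceding
    -- assignment.
    suffices hs : ∀ t ≤ 8, WP (.seq (.store 3 rI rCur) <|
        .seq (.store 2 rCur (.add rI (.const 1))) <|
        .seq (.upTo 4 6 (.store 1 (look (.add (.const 2) rK)) (.add rI (.const 1)))) <|
        advance rBound)
          { s with reg := Function.update (Function.update s.reg 6 (G.d i)) 7 (G.prev i) }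
          fun s' t' => s'.reg 3 = i ∧
          ScanP G a (i + 1) { s' with reg := Function.update s'.reg 3 (i + 1) } ∧
          5 + (t + t') ≤ 62 + 30 * G.d i by
      refine wp_ite (fun h0 => wp_assign ?_) (fun h0 => wp_assign ?_)
      · have h0 : G.d i ≠ 0 := by simpa [Expr.eval] using h0
        have hp : G.prev i = G.lastAt i (G.o i 0) := by simp [NumNet.prev, h0]
        have := hs 8 (by omega)
        simpa [look, Expr.eval, Expr.cost, h.inp, h.pos, h.last, hp,
          hL.o i hi 0 (by omega)] using this
      · have h0 : G.d i = 0 := by simpa [Expr.eval] using h0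
        have hp : G.prev i = 0 := by simp [NumNet.prev, h0]
        have := hs 4 (by omega)
        simpa [look, Expr.eval, Expr.cost, hp] using this
    intro t ht
    refine wp_seq (wp_store (wp_seq (wp_store (wp_seq (wp_scanEdges hL hi ?_ ?_)))))
    · refine ⟨by simp [h.n], by simp [h.m], by simp [h.pos], by simp [h.ctr], by simp,
        by simp [h.base], by simp, by simp [h.inp], by simp [h.last], fun x => ?_, fun p hp => ?_,
        h.out⟩
      · simp only [Expr.eval, NumNet.nextAt]
        by_cases hx : x = G.prev i
        · simp [hx, h.ctr]
        · simp [hx, h.next, Ne.symm hx]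
      · simp only [Expr.eval]
        by_cases hx : p = i
        · simp [hx, h.ctr]
        · simp [hx, h.ctr, h.prev p (by omega)]
    · intro s' t' h' ht'
      refine wp_assign ⟨by simp [h'.ctr], ?_, ?_⟩
      · refine ⟨by simp [h'.n], by simp [h'.m], ?_, by simp, by simp [h'.base], by simp [h'.inp],
          fun j => ?_, by simp [h'.next], by simpa using h'.prev, h'.out⟩
        · simp [Expr.eval, h'.pos, h'.bound, posP_succ]
        · rw [NumNet.lastAt]
          exact h'.last j
      · simp only [Expr.cost]
        omega
  · intro s' t h ht
    refine hQ s' t h (ht.trans ?_)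
    simp [Finset.sum_add_distrib, ← Finset.mul_sum]
    omega

/-- The configuration while the transitions are read. -/
structure ScanT (G : NumNet) (a : ℕ → ℕ) (j : ℕ) (s : Config) : Prop where
  n : s.reg 0 = G.n
  m : s.reg 1 = G.m
  pos : s.reg 2 = posT G j
  ctr : s.reg 3 = j
  base : s.reg 5 = ∑ j' ∈ Finset.range j, G.c j'
  inp : s.arr 0 = a
  last : ∀ j, s.arr 1 j = G.last j
  next : ∀ p, s.arr 2 (p + 1) = G.next p
  prev : ∀ p < G.n, s.arr 3 p = G.prev p
  code : ∀ j' < j, s.arr 4 j' = G.c j'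
  out : s.out = []

theorem wp_scanTransitions (hL : Layout G a)
    (h : ScanT G a 0 { s with reg := Function.update s.reg 3 0 })
    (hQ : ∀ s' t, ScanT G a G.m s' → t ≤ 60 * G.m + 6 → Q s' t) :
    WP scanTransitions s Q := by
  refine wp_upTo (ScanT G a) (fun i => 52) h (fun k s h => ⟨h.ctr, h.m⟩) ?_ ?_
  · intro j hj s h
    refine wp_seq (wp_assign (wp_seq (wp_store (wp_seq (wp_assign (wp_assign ⟨?_, ?_, ?_⟩))))))
    · simp [h.ctr]
    · have hc : (look (.const 0)).eval s = G.c j := by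
        simp [look, Expr.eval, h.inp, h.pos, hL.c j hj]
      rw [hc]
      refine ⟨by simp [h.n], by simp [h.m], ?_, by simp, ?_, by simp [h.inp], by simp [h.last],
        by simp [h.next], by simpa using h.prev, fun j' hj' => ?_, h.out⟩
      · simp [look, Expr.eval, h.inp, h.pos, hL.e j hj, posT_succ]
      · simp [Expr.eval, h.base, Finset.sum_range_succ]
      · by_cases hx : j' = j
        · simp [Expr.eval, hx, h.ctr]
        · simp [Expr.eval, hx, h.ctr, h.code j' (by omega)]
    · simp [look, Expr.cost]
  · intro s' t h ht
    refine hQ s' t h (ht.trans ?_)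
    simp
    omega

end Encoder

/-! ### The written form of the encoding -/

namespace NumNet

theorem write_token (G : NumNet) (i : ℕ) :
    (G.token i).write = if G.prev i = 0 then [7, i] else [3, G.base + i, 0] := by
  unfold token
  split <;> simp [Proc.write, SeqProc.write, Act.write]

theorem write_emit (G : NumNet) (j : ℕ) :
    (G.emit j).write = (if G.c j = 0 then [1] else [2, G.c j - 1]) ++ [7, G.n + j] := by
  unfold emit Act.ofCode
  split <;> simp [Proc.write, SeqProc.write, Act.write]

theorem write_parList (l : List Proc) :
    (Proc.parList l).write = (l.flatMap fun Q => 5 :: Q.write) ++ [0] := by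
  induction l with
  | nil => simp [Proc.parList, Proc.write, SeqProc.write]
  | cons Q l ih =>
    simp only [Proc.parList, List.foldr_cons, Proc.write, List.flatMap_cons] at ih ⊢
    simp [ih]

theorem write_sumList (l : List SeqProc) :
    (SeqProc.sumList l).write = (l.flatMap fun Q => 4 :: Q.write) ++ [0] := by
  induction l with
  | nil => simp [SeqProc.sumList, SeqProc.write]
  | cons Q l ih =>
    simp only [SeqProc.sumList, List.foldr_cons, SeqProc.write, List.flatMap_cons] at ih ⊢
    simp [ih]

theorem write_resList (l : List ℕ) (Q : Proc) :
    (Proc.resList l Q).write = (l.flatMap fun a => [6, a]) ++ Q.write := by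
  induction l with
  | nil => simp [Proc.resList]
  | cons a l ih =>
    simp only [Proc.resList, List.foldr_cons, Proc.write, List.flatMap_cons] at ih ⊢
    simp [ih]

/-- The written form of the components for a transition without incoming edges. -/
def writeSources (G : NumNet) (j : ℕ) : List ℕ :=
  if G.last j = 0 then 5 :: (G.emit j).write else []

theorem flatMap_sources (G : NumNet) (j : ℕ) :
    ((G.sources j).flatMap fun Q => 5 :: Q.write) = G.writeSources j := by
  unfold sources writeSources
  split <;> simp [Proc.write]

/-- The written form of an equation for a place. -/
def writeCollector (G : NumNet) (i : ℕ) : List ℕ :=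
  if G.next i = 0 then
    ((List.range (G.d i)).flatMap fun k => 4 :: (G.emit (G.o i k)).write) ++ [0]
  else [2, G.base + (G.next i - 1), 7, G.next i - 1]

theorem write_collector (G : NumNet) (i : ℕ) : (G.collector i).write = G.writeCollector i := by
  unfold collector writeCollector
  split <;> simp [Proc.write, SeqProc.write, Act.write, write_sumList, List.flatMap_map]

theorem write_product (G : NumNet) (j : ℕ) : (G.product j).write = G.writeSources j ++
    (((List.range (G.e j)).flatMap fun k => 5 :: (G.token (G.u j k)).write) ++ [0]) := by
  simp [product, write_parList, flatMap_sources, List.flatMap_map]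

theorem write_encode (G : NumNet) : G.encode.write =
    ((List.range G.n).flatMap fun i => [6, G.base + i]) ++
    ((List.range G.n).flatMap fun i =>
      (List.range (G.w i)).flatMap fun _ => 5 :: (G.token i).write) ++
    (List.range G.m).flatMap G.writeSources ++ [0] ++
    ((List.range G.n).flatMap fun i => i :: (G.collector i).write) ++
    (List.range G.m).flatMap fun j => (G.n + j) :: (G.product j).write := by
  simp only [CCSSystem.write, encode, write_resList, write_parList, initial, channels,
    List.flatMap_append, List.flatMap_map, List.flatMap_assoc, List.append_assoc, flatMap_sources]

end NumNet

/-! ### Writing the encoding -/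

namespace Encoder

open Ram

/-- The configuration while the encoding is written: reading position, counter of the outer loop,
and output. -/
structure Printing (G : NumNet) (a : ℕ → ℕ) (pos i : ℕ) (out : List ℕ) (s : Config) : Prop where
  n : s.reg 0 = G.n
  m : s.reg 1 = G.m
  base : s.reg 5 = G.base
  inp : s.arr 0 = a
  last : ∀ j, s.arr 1 j = G.last j
  next : ∀ p, s.arr 2 (p + 1) = G.next p
  prev : ∀ p < G.n, s.arr 3 p = G.prev p
  code : ∀ j < G.m, s.arr 4 j = G.c j
  pos : s.reg 2 = pos
  ctr : s.reg 3 = i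
  out : s.out = out

variable {G : NumNet} {a : ℕ → ℕ} {s : Config} {Q : Config → ℕ → Prop} {pos i : ℕ}
  {out : List ℕ}

/-- The tables never change during output, so only registers and output have to be checked. -/
theorem Printing.update (h : Printing G a pos i out s) {s' : Config} {pos' i' : ℕ}
    {out' : List ℕ} (harr : s'.arr = s.arr) (h0 : s'.reg 0 = s.reg 0) (h1 : s'.reg 1 = s.reg 1)
    (h5 : s'.reg 5 = s.reg 5) (hpos : s'.reg 2 = pos') (hctr : s'.reg 3 = i')
    (hout : s'.out = out') : Printing G a pos' i' out' s' where
  n := h0.trans h.n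
  m := h1.trans h.m
  base := h5.trans h.base
  inp := harr ▸ h.inp
  last := harr ▸ h.last
  next := harr ▸ h.next
  prev := harr ▸ h.prev
  code := harr ▸ h.code
  pos := hpos
  ctr := hctr
  out := hout

/-- Each round may take 40 steps, to which the loop adds 8. -/
theorem wp_inner {b : ℕ} {c : Prog} (f : ℕ → List ℕ) (h : Printing G a pos i out s)
    (hb : s.reg 6 = b)
    (step : ∀ k < b, ∀ s out, Printing G a pos i out s → s.reg 4 = k → s.reg 6 = b →
      WP c s fun s' t => Printing G a pos i (out ++ f k) s' ∧ s'.reg 4 = k ∧ s'.reg 6 = b ∧ t ≤ 40)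
    (hQ : ∀ s' t, Printing G a pos i (out ++ (List.range b).flatMap f) s' → s'.reg 6 = b →
      t ≤ 48 * b + 6 → Q s' t) :
    WP (.upTo 4 6 c) s Q := by
  refine wp_upTo (fun k s => Printing G a pos i (out ++ (List.range k).flatMap f) s ∧
    s.reg 4 = k ∧ s.reg 6 = b) (fun _ => 40) ⟨?_, by simp, by simpa using hb⟩
    (fun k s h => h.2) ?_ ?_
  · exact h.update rfl (by simp) (by simp) (by simp) (by simp [h.pos]) (by simp [h.ctr])
      (by simp [h.out])
  · rintro k hk s ⟨h, h4, h6⟩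
    obtain ⟨s', t, hr, h', h4', h6', ht⟩ := step k hk s _ h h4 h6
    refine ⟨s', t, hr, h4', ⟨?_, by simp, by simpa using h6'⟩, ht⟩
    exact h'.update rfl (by simp) (by simp) (by simp) (by simp [h'.pos]) (by simp [h'.ctr])
      (by simp [h'.out, List.range_succ])
  · rintro s' t ⟨h, h4, h6⟩ ht
    refine hQ s' t h h6 (ht.trans ?_)
    simp
    omega

theorem wp_outer {b N i' : ℕ} {c : Prog} (pos : ℕ → ℕ) (f : ℕ → List ℕ) (cost : ℕ → ℕ)
    (hN : ∀ {pos i out s}, Printing G a pos i out s → s.reg b = N)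
    (h : Printing G a (pos 0) i' out s)
    (step : ∀ i < N, ∀ s out, Printing G a (pos i) i out s →
      WP c s fun s' t => Printing G a (pos (i + 1)) i (out ++ f i) s' ∧ t ≤ cost i)
    (hQ : ∀ s' t, Printing G a (pos N) N (out ++ (List.range N).flatMap f) s' →
      t ≤ ∑ i ∈ Finset.range N, (cost i + 8) + 6 → Q s' t) :
    WP (.upTo 3 b c) s Q := by
  refine wp_upTo (fun i s => Printing G a (pos i) i (out ++ (List.range i).flatMap f) s) cost ?_
    (fun k s h => ⟨h.ctr, hN h⟩) ?_ hQ
  · exact h.update rfl (by simp) (by simp) (by simp) (by simp [h.pos]) (by simp) (by simp [h.out])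
  · intro i hi s h
    obtain ⟨s', t, hr, h', ht⟩ := step i hi s _ h
    refine ⟨s', t, hr, h'.ctr, ?_, ht⟩
    exact h'.update rfl (by simp) (by simp) (by simp) (by simp [h'.pos]) (by simp)
      (by simp [h'.out, List.range_succ])

theorem wp_print {l : List Expr} (h : Q { s with out := s.out ++ l.map (Expr.eval s) }
    ((l.map fun e => 1 + e.cost).sum + 1)) : WP (print l) s Q := by
  -- Expressions do not read the output, so all values may be computed in the initial configuration.
  have eval_out : ∀ (e : Expr) (o : List ℕ), Expr.eval { s with out := o } e = Expr.eval s e := by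
    intro e o
    induction e with
    | const | reg => rfl
    | get A e ih => simp only [Expr.eval, ih]
    | add e e' ih ih' => simp only [Expr.eval, ih, ih']
    | sub e e' ih ih' => simp only [Expr.eval, ih, ih']
  have key : ∀ (o : List ℕ) (Q : Config → ℕ → Prop),
      Q { s with out := o ++ l.map (Expr.eval s) } ((l.map fun e => 1 + e.cost).sum + 1) →
      WP (print l) { s with out := o } Q := by
    intro o
    clear h
    induction l generalizing o with
    | nil =>
      intro Q h
      exact wp_skip (by simpa using h)
    | cons e l ih =>
      intro Q h
      refine wp_seq (wp_output (ih _ _ ?_))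
      simpa [eval_out, add_assoc] using h
  exact key s.out Q h

theorem wp_printToken {q : ℕ} (h : Printing G a pos i out s) (h7 : s.reg 7 = q) (hq : q < G.n)
    (hQ : ∀ t ≤ 20, Q { s with out := out ++ (G.token q).write } t) : WP printToken s Q := by
  have hp : (Expr.get 3 rCur).eval s = G.prev q := by simp [Expr.eval, h7, h.prev q hq]
  refine wp_ite (fun h0 => wp_print ?_) (fun h0 => wp_print ?_)
  · rw [hp] at h0
    rw [NumNet.write_token, if_neg h0] at hQ
    simpa [Expr.eval, h7, h.base, h.out] using hQ _ (by simp [Expr.cost])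
  · rw [hp] at h0
    rw [NumNet.write_token, if_pos h0] at hQ
    simpa [Expr.eval, h7, h.out] using hQ _ (by simp [Expr.cost])

theorem wp_printEmit {j : ℕ} (h : Printing G a pos i out s) (h7 : s.reg 7 = j) (hj : j < G.m)
    (hQ : ∀ t ≤ 20, Q { s with out := out ++ (G.emit j).write } t) : WP printEmit s Q := by
  have hp : (Expr.get 4 rCur).eval s = G.c j := by simp [Expr.eval, h7, h.code j hj]
  refine wp_seq (wp_ite (fun h0 => wp_print (wp_print ?_)) (fun h0 => wp_print (wp_print ?_)))
  · rw [hp] at h0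
    rw [NumNet.write_emit, if_neg h0] at hQ
    simpa [Expr.eval, h7, h.code j hj, h.n, h.out] using hQ _ (by simp [Expr.cost])
  · rw [hp] at h0
    rw [NumNet.write_emit, if_pos h0] at hQ
    simpa [Expr.eval, h7, h.n, h.out] using hQ _ (by simp [Expr.cost])

theorem wp_printSources {j : ℕ} (h : Printing G a pos i out s) (h7 : s.reg 7 = j) (hj : j < G.m)
    (hQ : ∀ t ≤ 30, Q { s with out := out ++ G.writeSources j } t) : WP printSources s Q := by
  have hp : (Expr.get 1 rCur).eval s = G.last j := by simp [Expr.eval, h7, h.last j]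
  refine wp_ite (fun h0 => wp_skip ?_) (fun h0 => wp_seq (wp_output ?_))
  · rw [hp] at h0
    rw [NumNet.writeSources, if_neg h0, List.append_nil, ← h.out] at hQ
    exact hQ _ (by simp [Expr.cost])
  · rw [hp] at h0
    rw [NumNet.writeSources, if_pos h0] at hQ
    refine wp_printEmit (out := out ++ [5]) (h.update rfl rfl rfl rfl h.pos h.ctr ?_) h7 hj ?_
    · simp [Expr.eval, h.out]
    · intro t ht
      simpa using hQ _ (by simp [Expr.cost]; omega)

theorem wp_printChannels (h : Printing G a pos i out s)
    (hQ : ∀ s' t, Printing G a pos G.n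
      (out ++ (List.range G.n).flatMap fun i => [6, G.base + i]) s' →
      t ≤ 28 * G.n + 6 → Q s' t) : WP printChannels s Q := by
  refine wp_outer (fun _ => pos) (fun i => [6, G.base + i]) (fun _ => 20) (fun h => h.n) h ?_ ?_
  · intro i hi s out h
    refine wp_print ⟨?_, by simp [Expr.cost]⟩
    exact h.update rfl rfl rfl rfl h.pos h.ctr (by simp [Expr.eval, h.base, h.ctr, h.out])
  · intro s' t h ht
    refine hQ s' t h (ht.trans ?_)
    simp
    omega

/-- The reading position restarts at 2, behind the two counts; after all place records it has
reached the first transition record. -/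
theorem wp_printMarking (hL : Layout G a) (h : Printing G a pos i out s)
    (hQ : ∀ s' t, Printing G a (posT G 0) G.n (out ++ (List.range G.n).flatMap fun i =>
      (List.range (G.w i)).flatMap fun _ => 5 :: (G.token i).write) s' →
      t ≤ 50 * G.n + 48 * ∑ i ∈ Finset.range G.n, G.w i + 8 → Q s' t) : WP printMarking s Q := by
  refine wp_seq (wp_assign (wp_outer (i' := i) (posP G)
    (fun i => (List.range (G.w i)).flatMap fun _ => 5 :: (G.token i).write)
    (fun i => 40 + 48 * G.w i)
    (fun h => h.n) (h.update rfl (by simp) (by simp) (by simp) (by simp [Expr.eval, posP])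
      (by simp [h.ctr]) h.out) ?_ ?_))
  · intro i hi s out h
    have hw : (look (.const 0)).eval s = G.w i := by
      simp [look, Expr.eval, h.inp, h.pos, hL.w i hi]
    refine wp_seq (wp_assign (wp_seq (wp_inner (pos := posP G i) (i := i) (out := out)
      (fun _ => 5 :: (G.token i).write)
      (h.update rfl (by simp) (by simp) (by simp) (by simp [h.pos]) (by simp [h.ctr]) h.out)
      (by simpa using hw) ?_ ?_)))
    · intro k hk s out h h4 h6
      refine wp_seq (wp_output (wp_seq (wp_assign (wp_printToken (q := i) (pos := posP G i) (i := i)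
        (out := out ++ [5])
        (h.update rfl (by simp) (by simp) (by simp) (by simp [h.pos]) (by simp [h.ctr])
          (by simp [h.out, Expr.eval])) (by simp [Expr.eval, h.ctr]) hi ?_))))
      intro t ht
      refine ⟨h.update rfl (by simp) (by simp) (by simp) (by simp [h.pos]) (by simp [h.ctr])
        (by simp), by simp [h4], by simp [h6], ?_⟩
      simp only [Expr.cost]
      omega
    · intro s' t h h6 ht
      refine wp_assign ⟨h.update rfl (by simp) (by simp) (by simp) ?_ (by simp [h.ctr]) h.out, ?_⟩
      · simp [look, Expr.eval, h.inp, h.pos, hL.d i hi, posP_succ]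
      · simp only [look, Expr.cost]
        omega
  · intro s' t h ht
    refine hQ s' _ (by simpa [posT] using h) ?_
    simp [Finset.sum_add_distrib, ← Finset.mul_sum] at ht
    simp only [Expr.cost]
    omega

theorem wp_printAllSources (h : Printing G a pos i out s)
    (hQ : ∀ s' t, Printing G a pos G.m (out ++ (List.range G.m).flatMap G.writeSources) s' →
      t ≤ 48 * G.m + 6 → Q s' t) : WP printAllSources s Q := by
  refine wp_outer (fun _ => pos) G.writeSources (fun _ => 40) (fun h => h.m) h ?_ ?_
  · intro i hi s out h
    refine wp_seq (wp_assign (wp_printSources (pos := pos) (i := i) (out := out)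
      (h.update rfl (by simp) (by simp) (by simp) (by simp [h.pos]) (by simp [h.ctr]) h.out)
      (by simp [Expr.eval, h.ctr]) hi fun t ht => ⟨?_, ?_⟩))
    · exact h.update rfl (by simp) (by simp) (by simp) (by simp [h.pos]) (by simp [h.ctr]) rfl
    · simp only [Expr.cost]
      omega
  · intro s' t h ht
    refine hQ s' t h (ht.trans ?_)
    simp
    omega

/-- This second pass over the place records again ends at `posT G 0`, where the transition equations
take up the reading. -/
theorem wp_printCollectors (hL : Layout G a) (hG : G.Valid) (h : Printing G a pos i out s)
    (hQ : ∀ s' t, Printing G a (posT G 0) G.n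
      (out ++ (List.range G.n).flatMap fun i => i :: (G.collector i).write) s' →
      t ≤ 70 * G.n + 48 * ∑ i ∈ Finset.range G.n, G.d i + 8 → Q s' t) :
    WP printCollectors s Q := by
  refine wp_seq (wp_assign (wp_outer (i' := i) (posP G)
    (fun i => i :: (G.collector i).write) (fun i => 60 + 48 * G.d i)
    (fun h => h.n) (h.update rfl (by simp) (by simp) (by simp) (by simp [Expr.eval, posP])
      (by simp [h.ctr]) h.out) ?_ ?_))
  · intro i hi s out h
    have hd : (look (.const 1)).eval { s with out := s.out ++ [rI.eval s] } = G.d i := by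
      simp [look, Expr.eval, h.inp, h.pos, hL.d i hi]
    refine wp_seq (wp_output (wp_seq (wp_assign (wp_seq (wp_assign (wp_seq ?_))))))
    rw [hd]
    have hn : (Expr.get 2 (.add rI (.const 1))).eval
        { s with reg := Function.update s.reg 6 (G.d i), out := s.out ++ [rI.eval s] } =
        G.next i := by
      simp [Expr.eval, h.ctr, h.next]
    rw [hn]
    have h' : Printing G a (posP G i) i (out ++ [i]) { s with
        reg := Function.update (Function.update s.reg 6 (G.d i)) 7 (G.next i),
        out := s.out ++ [rI.eval s] } :=
      h.update rfl (by simp) (by simp) (by simp) (by simp [h.pos]) (by simp [h.ctr])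
        (by simp [h.out, h.ctr, Expr.eval])
    refine wp_ite (fun h0 => wp_print (wp_assign ⟨?_, ?_⟩)) (fun h0 => wp_seq (wp_inner
      (fun k => 4 :: (G.emit (G.o i k)).write) h' (b := G.d i) (by simp) ?_ ?_))
    · have h0 : G.next i ≠ 0 := by simpa [Expr.eval] using h0
      refine h.update rfl (by simp) (by simp) (by simp) ?_ (by simp [h.ctr]) ?_
      · simp [Expr.eval, h.pos, posP_succ]
      · simp [Expr.eval, h.out, h.ctr, h.base, NumNet.write_collector, NumNet.writeCollector, h0]
    · simp [look, Expr.cost]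
      omega
    · intro k hk s out h h4 h6
      have ho : (look (.add (.const 2) rK)).eval { s with out := s.out ++ [4] } = G.o i k := by
        simp [look, Expr.eval, h.inp, h.pos, h4, hL.o i hi k hk]
      refine wp_seq (wp_output (wp_seq (wp_assign (wp_printEmit (j := G.o i k) (pos := posP G i)
        (i := i) (out := out ++ [4])
        (h.update rfl (by simp) (by simp) (by simp) (by simp [h.pos]) (by simp [h.ctr])
          (by simp [h.out, Expr.eval])) (by simp only [Function.update_self]; exact ho) (hG.o_lt i hi k hk) ?_))))
      intro t ht
      refine ⟨h.update rfl (by simp) (by simp) (by simp) (by simp [h.pos]) (by simp [h.ctr])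
        (by simp), by simp [h4], by simp [h6], ?_⟩
      simp only [look, Expr.cost]
      omega
    · intro s' t h6 hb ht
      have h0 : G.next i = 0 := by simpa [Expr.eval] using h0
      refine wp_output (wp_assign ⟨h6.update rfl (by simp) (by simp) (by simp) ?_
        (by simp [h6.ctr]) ?_, ?_⟩)
      · simp [Expr.eval, h6.pos, hb, posP_succ]
      · simp [Expr.eval, h6.out, NumNet.write_collector, NumNet.writeCollector, h0]
      · simp only [look, Expr.cost]
        omega
  · intro s' t h ht
    refine hQ s' _ (by simpa [posT] using h) ?_
    simp [Finset.sum_add_distrib, ← Finset.mul_sum] at ht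
    simp only [Expr.cost]
    omega

theorem wp_printProducts (hL : Layout G a) (hG : G.Valid) (h : Printing G a (posT G 0) i out s)
    (hQ : ∀ s' t, Printing G a (posT G G.m) G.m
      (out ++ (List.range G.m).flatMap fun j => (G.n + j) :: (G.product j).write) s' →
      t ≤ 90 * G.m + 48 * ∑ j ∈ Finset.range G.m, G.e j + 6 → Q s' t) :
    WP printProducts s Q := by
  refine wp_outer (posT G) (fun j => (G.n + j) :: (G.product j).write)
    (fun j => 80 + 48 * G.e j) (fun h => h.m) h ?_ ?_
  · intro j hj s out h
    refine wp_seq (wp_output (wp_seq (wp_assign (wp_seq (wp_printSources (pos := posT G j) (i := j)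
      (j := j) (out := out ++ [G.n + j])
      (h.update rfl (by simp) (by simp) (by simp) (by simp [h.pos]) (by simp [h.ctr])
        (by simp [Expr.eval, h.n, h.ctr, h.out])) (by simp [Expr.eval, h.ctr]) hj ?_)))))
    intro t ht
    refine wp_seq (wp_assign (wp_seq (wp_inner (pos := posT G j) (i := j) (b := G.e j)
      (out := out ++ [G.n + j] ++ G.writeSources j)
      (fun k => 5 :: (G.token (G.u j k)).write)
      (h.update rfl (by simp) (by simp) (by simp) (by simp [h.pos]) (by simp [h.ctr]) rfl) ?_
      ?_ ?_)))
    · simp [look, Expr.eval, h.inp, h.pos, hL.e j hj]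
    · intro k hk s out h h4 h6
      have ho : (look (.add (.const 2) rK)).eval { s with out := s.out ++ [5] } = G.u j k := by
        simp [look, Expr.eval, h.inp, h.pos, h4, hL.u j hj k hk]
      refine wp_seq (wp_output (wp_seq (wp_assign (wp_printToken (q := G.u j k) (pos := posT G j)
        (i := j) (out := out ++ [5])
        (h.update rfl (by simp) (by simp) (by simp) (by simp [h.pos]) (by simp [h.ctr])
          (by simp [h.out, Expr.eval])) (by simp only [Function.update_self]; exact ho) (hG.u_lt j hj k hk) ?_))))
      intro t ht
      refine ⟨h.update rfl (by simp) (by simp) (by simp) (by simp [h.pos]) (by simp [h.ctr])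
        (by simp), by simp [h4], by simp [h6], ?_⟩
      simp only [look, Expr.cost]
      omega
    · intro s' t' h' hb ht'
      refine wp_seq (wp_output (wp_assign ⟨h'.update rfl (by simp) (by simp) (by simp) ?_
        (by simp [h'.ctr]) ?_, ?_⟩))
      · simp [Expr.eval, h'.pos, hb, posT_succ]
      · simp [Expr.eval, h'.out, NumNet.write_product]
      · simp only [look, Expr.cost]
        omega
  · intro s' t h ht
    refine hQ s' t h (ht.trans ?_)
    simp [Finset.sum_add_distrib, ← Finset.mul_sum]
    omega

/-- The phases sum to coefficients of at most 218 (that of `n`), plus a small constant, so 500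
leaves ample room. -/
theorem wp_encoder (hL : Layout G a) (hG : G.Valid) (hreg : ∀ x, s.reg x = 0)
    (h0 : s.arr 0 = a) (harr : ∀ A x, A ≠ 0 → s.arr A x = 0) (hout : s.out = []) :
    WP encoder s fun s' t => s'.out = G.encode.write ∧ t ≤ 500 * (G.total + 1) := by
  refine wp_seq (wp_assign (wp_seq (wp_assign (wp_seq (wp_assign (wp_seq
    (wp_scanPlaces hL ?_ ?_)))))))
  · refine ⟨?_, ?_, ?_, by simp, by simp [hreg], h0, ?_, ?_, by simp, hout⟩
    · simp [Expr.eval, h0, hL.n]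
    · simp [Expr.eval, h0, hL.m]
    · simp [Expr.eval, posP]
    · simp [harr, NumNet.lastAt]
    · simp [harr, NumNet.nextAt]
  intro s₁ t₁ h₁ ht₁
  refine wp_seq (wp_scanTransitions hL ?_ ?_)
  -- From here on only cells `p + 1` of array 2 matter; cell 0 gathers the places without
  -- predecessor and is never read.
  · refine ⟨by simp [h₁.n], by simp [h₁.m], by simp [h₁.pos, posT], by simp, by simp [h₁.base],
      h₁.inp, h₁.last, fun p => h₁.next _, h₁.prev, by simp, h₁.out⟩
  intro s₂ t₂ h₂ ht₂
  have hp : Printing G a (posT G G.m) G.m [] s₂ :=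
    ⟨h₂.n, h₂.m, h₂.base, h₂.inp, h₂.last, h₂.next, h₂.prev, h₂.code, h₂.pos, h₂.ctr, h₂.out⟩
  refine wp_seq (wp_printChannels hp fun s₃ t₃ h₃ ht₃ => wp_seq (wp_printMarking hL h₃
    fun s₄ t₄ h₄ ht₄ => wp_seq (wp_printAllSources h₄ fun s₅ t₅ h₅ ht₅ => wp_seq (wp_output
    (wp_seq (wp_printCollectors hL hG (h₅.update rfl rfl rfl rfl h₅.pos h₅.ctr rfl)
    fun s₆ t₆ h₆ ht₆ => wp_printProducts hL hG h₆ fun s₇ t₇ h₇ ht₇ => ⟨?_, ?_⟩))))))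
  · rw [h₇.out, NumNet.write_encode, h₅.out]
    simp [Expr.eval]
  · simp only [Expr.cost, NumNet.total]
    omega

/-! ### The layout of the input -/

/-- The `i`-th record starts after the lengths of all earlier ones; splitting the range at `i`
isolates it. -/
theorem getD_flatMap_range {n : ℕ} (f : ℕ → List ℕ) (pre post : List ℕ) {i k : ℕ} (hi : i < n)
    (hk : k < (f i).length) :
    (pre ++ ((List.range n).flatMap f ++ post)).getD
      (pre.length + ∑ i' ∈ Finset.range i, (f i').length + k) 0 = (f i).getD k 0 := by
  obtain ⟨l, rfl⟩ : ∃ l, n = i + 1 + l := ⟨n - i - 1, by omega⟩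
  have hlen : ((List.range i).flatMap f).length = ∑ i' ∈ Finset.range i, (f i').length := by
    rw [List.length_flatMap, NumNet.sum_map_range]
  rw [List.range_add, List.range_succ, List.flatMap_append, List.flatMap_append, add_assoc,
    List.getD_append_right _ _ _ _ (by omega), Nat.add_sub_cancel_left, List.append_assoc,
    List.append_assoc, List.getD_append_right _ _ _ _ (by omega), hlen, Nat.add_sub_cancel_left,
    List.flatMap_singleton, List.getD_append _ _ _ _ hk]

theorem layout_of_eq {l : List ℕ} (h : l = G.n :: G.m ::
    (((List.range G.n).flatMap fun i => G.w i :: G.d i :: (List.range (G.d i)).map (G.o i)) ++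
      (List.range G.m).flatMap fun j => G.c j :: G.e j :: (List.range (G.e j)).map (G.u j))) :
    Layout G fun i => l.getD i 0 := by
  set f := fun i => G.w i :: G.d i :: (List.range (G.d i)).map (G.o i) with hf
  set g := fun j => G.c j :: G.e j :: (List.range (G.e j)).map (G.u j) with hg
  have hfl : ∀ i, (f i).length = 2 + G.d i := fun i => by simp [hf]; omega
  have hgl : ∀ i, (g i).length = 2 + G.e i := fun i => by simp [hg]; omega
  have hP : ∀ i < G.n, ∀ k < 2 + G.d i, l.getD (posP G i + k) 0 = (f i).getD k 0 := by
    intro i hi k hk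
    have := getD_flatMap_range f [G.n, G.m] ((List.range G.m).flatMap g) hi
      (k := k) (by rw [hfl]; exact hk)
    rw [← this, h]
    simp [posP, hfl]
  have hT : ∀ j < G.m, ∀ k < 2 + G.e j, l.getD (posT G j + k) 0 = (g j).getD k 0 := by
    intro j hj k hk
    -- For transition records the prefix comprises the two counts and all place records.
    have := getD_flatMap_range g (G.n :: G.m :: (List.range G.n).flatMap f) [] hj
      (k := k) (by rw [hgl]; exact hk)
    rw [← this, h]
    simp only [posT, posP, hgl, List.length_cons, List.length_flatMap, NumNet.sum_map_range, hfl,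
      List.append_nil, List.cons_append]
    congr 1
    omega
  refine ⟨by simp [h], by simp [h], ?_, ?_, ?_, ?_, ?_, ?_⟩
  · exact fun i hi => by simpa [hf] using hP i hi 0 (by omega)
  · exact fun i hi => by simpa [hf] using hP i hi 1 (by omega)
  · intro i hi k hk
    rw [hP i hi (2 + k) (by omega), add_comm 2 k]
    simp [hf, hk]
  · exact fun j hj => by simpa [hg] using hT j hj 0 (by omega)
  · exact fun j hj => by simpa [hg] using hT j hj 1 (by omega)
  · intro j hj k hk
    rw [hT j hj (2 + k) (by omega), add_comm 2 k]
    simp [hg, hk]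

end Encoder

-- The written adjacency list has the expected layout

namespace PetriNet.AdjacencyList

variable {P T : Type*} [Fintype P] [Fintype T] {N : PetriNet P T}

theorem flatMap_finRange (n : ℕ) (f : Fin n → List ℕ) (g : ℕ → List ℕ) (h : ∀ i, f i = g i) :
    (List.finRange n).flatMap f = (List.range n).flatMap g := by
  rw [← List.map_coe_finRange_eq_range, List.flatMap_map]
  exact congrArg (List.flatMap · _) (funext h)

theorem map_range_getD (l : List ℕ) : (List.range l.length).map (fun k => l.getD k 0) = l := by
  refine List.ext_getElem (by simp) fun i h1 h2 => ?_
  simp [List.getElem?_eq_getElem h2]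

theorem layout (L : N.AdjacencyList) (M₀ : P → ℕ) :
    Encoder.Layout (L.toNumNet M₀) fun i => (L.write M₀).getD i 0 := by
  refine Encoder.layout_of_eq ?_
  have h1 : ∀ i, (List.range ((L.toNumNet M₀).d i)).map ((L.toNumNet M₀).o i) =
      L.placeTargets i := fun i => map_range_getD _
  have h2 : ∀ j, (List.range ((L.toNumNet M₀).e j)).map ((L.toNumNet M₀).u j) =
      L.transTargets j := fun j => map_range_getD _
  simp only [h1, h2, write]
  simp only [toNumNet]
  rw [flatMap_finRange, flatMap_finRange]
  · intro j
    simp [transTargets]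
  · intro i
    simp [placeTargets]

end PetriNet.AdjacencyList

end NetToCCS

theorem mainTheorem1 :
    ∃ (encoder : Ram.Prog) (C : ℕ),
      ∀ (P T : Type*) [Fintype P] [Fintype T] (N : PetriNet P T) (M₀ : P → ℕ)
        (L : N.AdjacencyList), N.IsGroupChoice →
        ∃ (S : CCSSystem) (time : ℕ),
          Ram.Computes encoder (L.write M₀) S.write time ∧
          S.WellFormed ∧
          LTS.WeaklyBisimilar (N.toLTS M₀) S.toLTS ∧
          ((N.toLTS M₀).HasDivergentPath ↔ S.toLTS.HasDivergentPath) ∧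
          time ≤ C * (N.size + (∑ p, M₀ p) + 1) ∧
          S.size ≤ C * (N.size + (∑ p, M₀ p) + 1) := by
  -- The constant is dictated by the running time; the size bound needs only 9.
  refine ⟨Encoder.encoder, 500, fun P T _ _ N M₀ L hN => ?_⟩
  obtain ⟨s', t, hr, hout, ht⟩ := Encoder.wp_encoder (s := Ram.start (L.write M₀)) (L.layout M₀)
    (L.valid_toNumNet M₀ hN) (fun _ => rfl) (by funext i; simp [Ram.start])
    (fun A x hA => by simp [Ram.start, hA]) rfl
  have hE := L.isExpansion M₀ hN
  have h0 := L.related_init M₀ hN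
  rw [L.total_toNumNet] at ht
  refine ⟨(L.toNumNet M₀).encode, t, ⟨s', hr, hout⟩, (L.toNumNet M₀).encode_wellFormed,
    hE.weaklyBisimilar h0, hE.hasDivergentPath_iff h0, ht, ?_⟩
  have := (L.toNumNet M₀).encode_size_le
  rw [L.total_toNumNet] at this
  omega
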